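/- For $T>0$ and a real-valued $V\in L^2[0,T]$, let $H_V^{\mathrm{per}}=-\frac{d^2}{dx^2}+V$ be the Schrödinger operator on $L^2[0,T]$ with periodic boundary conditions, i.e. with domain $\{u\in H^2[0,T] : u(T)=u(0),\ u'(T)=u'(0)\}$, and put $\|V\|=\left(\frac1T\int_0^T|V(x)|^2\,dx\right)^{1/2}$. There is a universal constant $C_1>0$ such that the following holds for all $T>0$, all $Q>0$ and all real-valued $V_1,V_2\in L^2[0,T]$ with $\|V_1\|\le Q$ and $\|V_2\|\le Q$. For $j=1,2$, the eigenvalues of $H_{V_j}^{\mathrm{per}}$ are real, have finite multiplicity, and can be listed in increasing order, counted with multiplicity, as an infinite sequence $E_{1,V_j}\le E_{2,V_j}\le\cdots$; moreover $$E_{1,V_j}\ \ge\ -C_1\left(Q+T^2Q^2\right)\qquad (j=1,2)$$ and, for every $n\ge 1$, $$\left|E_{n,V_1}-E_{n,V_2}\right|\ \le\ C_1\left(1+T^2Q\right)\left(1+T\,|E_{n,V_2}|^{1/2}\right)\|V_1-V_2\| .$$ -/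

import Mathlib

open MeasureTheory Filter Topology

/-- The normalized norm `(T⁻¹ ∫₀ᵀ |V|²)^{1/2}` of `V ∈ L²[0,T]`. It is the Besicovitch norm of the
`T`-periodic extension of `V`, see `tendsto_periodNorm`. -/
noncomputable def periodNorm (T : ℝ) (V : ℝ → ℝ) : ℝ :=
  Real.sqrt (T⁻¹ * ∫ x in (0 : ℝ)..T, |V x| ^ 2)

/-- For a `T`-periodic, locally square-integrable `V`, the Besicovitch norm
`lim_{R → ∞} ((2R)⁻¹ ∫_{-R}^{R} |V|²)^{1/2}` exists and equals `periodNorm T V`. -/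
theorem tendsto_periodNorm {T : ℝ} (hT : 0 < T) {V : ℝ → ℝ} (hV : Function.Periodic V T)
    (hint : IntervalIntegrable (fun x => |V x| ^ 2) volume 0 T) :
    Tendsto (fun R : ℝ => Real.sqrt ((2 * R)⁻¹ * ∫ x in (-R)..R, |V x| ^ 2)) atTop
      (𝓝 (periodNorm T V)) := by
  set g : ℝ → ℝ := fun x => |V x| ^ 2 with hg
  have hgp : Function.Periodic g T := fun x => by simp only [hg, hV x]
  have hgi : ∀ a b, IntervalIntegrable g volume a b := hgp.intervalIntegrable₀ hT.ne' hint
  have hg0 : ∀ x, 0 ≤ g x := fun x => by positivity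
  set I : ℝ := ∫ x in (0 : ℝ)..T, g x with hI
  have hI0 : 0 ≤ I := intervalIntegral.integral_nonneg hT.le fun x _ => hg0 x
  have hper : ∀ (n : ℤ) (t : ℝ), ∫ x in t..t + n • T, g x = n * I := fun n t => by
    rw [hgp.intervalIntegral_add_zsmul_eq n t hgi, hgp.intervalIntegral_add_eq t 0, zero_add,
      zsmul_eq_mul]
  have hmono : ∀ a b c : ℝ, b ≤ c → ∫ x in a..b, g x ≤ ∫ x in a..c, g x := fun a b c hbc => by
    rw [← intervalIntegral.integral_add_adjacent_intervals (hgi a b) (hgi b c)]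
    linarith [intervalIntegral.integral_nonneg (μ := volume) hbc fun x _ => hg0 x]
  refine (Real.continuous_sqrt.tendsto _).comp ?_
  have hlim : Tendsto (fun R : ℝ => (2 * R)⁻¹ * I) atTop (𝓝 0) := by
    have h2 : Tendsto (fun R : ℝ => 2 * R) atTop atTop :=
      tendsto_id.const_mul_atTop (by norm_num)
    simpa using (tendsto_inv_atTop_zero.comp h2).mul_const I
  have hlow : Tendsto (fun R : ℝ => T⁻¹ * I - (2 * R)⁻¹ * I) atTop (𝓝 (T⁻¹ * I)) := by
    simpa using tendsto_const_nhds.sub hlim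
  have hupp : Tendsto (fun R : ℝ => T⁻¹ * I + (2 * R)⁻¹ * I) atTop (𝓝 (T⁻¹ * I)) := by
    simpa using tendsto_const_nhds.add hlim
  refine tendsto_of_tendsto_of_tendsto_of_le_of_le' hlow hupp ?_ ?_
  · filter_upwards [eventually_gt_atTop 0] with R hR
    have h1 := hmono (-R) (-R + ⌊2 * R / T⌋ • T) R (by
      have := Int.floor_le (2 * R / T)
      rw [le_div_iff₀ hT] at this
      rw [zsmul_eq_mul]; linarith)
    rw [hper] at h1
    have h2 : (2 * R / T - 1) * I ≤ ⌊2 * R / T⌋ * I :=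
      mul_le_mul_of_nonneg_right (Int.sub_one_lt_floor _).le hI0
    calc T⁻¹ * I - (2 * R)⁻¹ * I = (2 * R)⁻¹ * ((2 * R / T - 1) * I) := by field_simp
      _ ≤ _ := mul_le_mul_of_nonneg_left (h2.trans h1) (by positivity)
  · filter_upwards [eventually_gt_atTop 0] with R hR
    have h1 := hmono (-R) R (-R + (⌊2 * R / T⌋ + 1) • T) (by
      have := Int.lt_floor_add_one (2 * R / T)
      rw [div_lt_iff₀ hT] at this
      rw [zsmul_eq_mul]; push_cast; linarith)
    rw [hper] at h1
    have h2 : ((⌊2 * R / T⌋ + 1 : ℤ) : ℝ) * I ≤ (2 * R / T + 1) * I := by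
      push_cast
      exact mul_le_mul_of_nonneg_right (by linarith [Int.floor_le (2 * R / T)]) hI0
    calc _ ≤ (2 * R)⁻¹ * ((2 * R / T + 1) * I) :=
          mul_le_mul_of_nonneg_left (h1.trans h2) (by positivity)
      _ = T⁻¹ * I + (2 * R)⁻¹ * I := by field_simp

/-- The Hilbert space `L²[0,T]` of complex-valued functions. -/
abbrev L2Period (T : ℝ) : Type := Lp ℂ 2 (volume.restrict (Set.Icc (0 : ℝ) T))

/-- `u` is a function in the Sobolev space `H²[0,T]` with (absolutely continuous) first derivative
`v` and second derivative `w ∈ L²[0,T]`, and it satisfies the periodic boundary conditions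
`u(T) = u(0)`, `u'(T) = u'(0)`. -/
structure IsPeriodicH2 (T : ℝ) (u v w : ℝ → ℂ) : Prop where
  memLp : MemLp w 2 (volume.restrict (Set.Icc (0 : ℝ) T))
  eq_integral : ∀ x ∈ Set.Icc (0 : ℝ) T, u x = u 0 + ∫ t in (0 : ℝ)..x, v t
  deriv_eq_integral : ∀ x ∈ Set.Icc (0 : ℝ) T, v x = v 0 + ∫ t in (0 : ℝ)..x, w t
  periodic : u T = u 0
  deriv_periodic : v T = v 0

namespace IsPeriodicH2

variable {T : ℝ} {u v w u' v' w' : ℝ → ℂ}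

theorem integrableOn (h : IsPeriodicH2 T u v w) : IntegrableOn w (Set.Icc 0 T) :=
  h.memLp.integrable (by norm_num)

theorem continuousOn_deriv (h : IsPeriodicH2 T u v w) : ContinuousOn v (Set.Icc 0 T) := by
  rcases le_or_gt 0 T with hT | hT
  · have hc : ContinuousOn (fun x => v 0 + ∫ t in (0 : ℝ)..x, w t) (Set.Icc 0 T) := by
      have := intervalIntegral.continuousOn_primitive_interval (a := 0) (b := T) (f := w)
        (μ := volume) (by rw [Set.uIcc_of_le hT]; exact h.integrableOn)
      rw [Set.uIcc_of_le hT] at this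
      exact continuousOn_const.add this
    exact hc.congr h.deriv_eq_integral
  · simp [Set.Icc_eq_empty hT.not_ge]

theorem continuousOn (h : IsPeriodicH2 T u v w) : ContinuousOn u (Set.Icc 0 T) := by
  rcases le_or_gt 0 T with hT | hT
  · have hc : ContinuousOn (fun x => u 0 + ∫ t in (0 : ℝ)..x, v t) (Set.Icc 0 T) := by
      have := intervalIntegral.continuousOn_primitive_interval (a := 0) (b := T) (f := v)
        (μ := volume) (by rw [Set.uIcc_of_le hT]; exact h.continuousOn_deriv.integrableOn_Icc)
      rw [Set.uIcc_of_le hT] at this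
      exact continuousOn_const.add this
    exact hc.congr h.eq_integral
  · simp [Set.Icc_eq_empty hT.not_ge]

theorem intervalIntegrable (h : IsPeriodicH2 T u v w) {x : ℝ} (hx : x ∈ Set.Icc 0 T) :
    IntervalIntegrable w volume 0 x := by
  rw [intervalIntegrable_iff_integrableOn_Icc_of_le hx.1]
  exact h.integrableOn.mono_set (Set.Icc_subset_Icc_right hx.2)

theorem intervalIntegrable_deriv (h : IsPeriodicH2 T u v w) {x : ℝ} (hx : x ∈ Set.Icc 0 T) :
    IntervalIntegrable v volume 0 x := by
  rw [intervalIntegrable_iff_integrableOn_Icc_of_le hx.1]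
  exact h.continuousOn_deriv.integrableOn_Icc.mono_set (Set.Icc_subset_Icc_right hx.2)

theorem zero (T : ℝ) : IsPeriodicH2 T 0 0 0 := by
  constructor <;> simp

theorem add (h : IsPeriodicH2 T u v w) (h' : IsPeriodicH2 T u' v' w') :
    IsPeriodicH2 T (u + u') (v + v') (w + w') where
  memLp := h.memLp.add h'.memLp
  eq_integral x hx := by
    simp only [Pi.add_apply]
    rw [intervalIntegral.integral_add (h.intervalIntegrable_deriv hx)
      (h'.intervalIntegrable_deriv hx), h.eq_integral x hx, h'.eq_integral x hx]
    ring
  deriv_eq_integral x hx := by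
    simp only [Pi.add_apply]
    rw [intervalIntegral.integral_add (h.intervalIntegrable hx)
      (h'.intervalIntegrable hx), h.deriv_eq_integral x hx, h'.deriv_eq_integral x hx]
    ring
  periodic := by simp [h.periodic, h'.periodic]
  deriv_periodic := by simp [h.deriv_periodic, h'.deriv_periodic]

theorem smul (c : ℂ) (h : IsPeriodicH2 T u v w) : IsPeriodicH2 T (c • u) (c • v) (c • w) where
  memLp := h.memLp.const_smul c
  eq_integral x hx := by
    simp only [Pi.smul_apply, intervalIntegral.integral_smul]
    rw [h.eq_integral x hx, smul_add]
  deriv_eq_integral x hx := by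
    simp only [Pi.smul_apply, intervalIntegral.integral_smul]
    rw [h.deriv_eq_integral x hx, smul_add]
  periodic := by simp [h.periodic]
  deriv_periodic := by simp [h.deriv_periodic]

/-- The second derivative is determined, almost everywhere, by the class of the function. -/
theorem ae_eq_zero (h : IsPeriodicH2 T u v w)
    (hu : u =ᵐ[volume.restrict (Set.Icc (0 : ℝ) T)] 0) :
    w =ᵐ[volume.restrict (Set.Icc (0 : ℝ) T)] 0 := by
  rcases le_or_gt T 0 with hT | hT
  · have : (volume.restrict (Set.Icc (0 : ℝ) T)) = 0 := by
      rw [Measure.restrict_eq_zero, Real.volume_Icc]; simpa using hT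
    rw [this]; exact ae_eq_bot.2 rfl ▸ Filter.eventually_bot
  have hu0 : ∀ x ∈ Set.Icc 0 T, u x = 0 :=
    Measure.eqOn_Icc_of_ae_eq volume hT.ne hu h.continuousOn continuousOn_const
  have key : ∀ f : ℝ → ℂ, IntervalIntegrable f volume 0 T →
      (∀ x ∈ Set.Icc 0 T, ∫ t in (0 : ℝ)..x, f t = 0) →
      f =ᵐ[volume.restrict (Set.Icc (0 : ℝ) T)] 0 := by
    intro f hf hf0
    rw [← restrict_Ioo_eq_restrict_Icc]
    refine (ae_restrict_iff' measurableSet_Ioo).2 ?_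
    filter_upwards [hf.ae_hasDerivAt_integral] with x hx hxI
    have hxm : x ∈ Set.uIcc 0 T := by
      rw [Set.uIcc_of_le hT.le]; exact Set.Ioo_subset_Icc_self hxI
    have h1 := hx hxm 0 (by rw [Set.uIcc_of_le hT.le]; exact ⟨le_rfl, hT.le⟩)
    have h2 : HasDerivAt (fun y => ∫ t in (0 : ℝ)..y, f t) 0 x := by
      refine (hasDerivAt_const x (0 : ℂ)).congr_of_eventuallyEq ?_
      filter_upwards [Ioo_mem_nhds hxI.1 hxI.2] with y hy
      exact hf0 y (Set.Ioo_subset_Icc_self hy)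
    exact h1.unique h2
  have hTm : T ∈ Set.Icc 0 T := ⟨hT.le, le_rfl⟩
  have h0m : (0 : ℝ) ∈ Set.Icc 0 T := ⟨le_rfl, hT.le⟩
  have hv : v =ᵐ[volume.restrict (Set.Icc (0 : ℝ) T)] 0 :=
    key v (h.intervalIntegrable_deriv hTm) fun x hx => by
      have := h.eq_integral x hx
      rwa [hu0 x hx, hu0 0 h0m, zero_add, eq_comm] at this
  have hv0 : ∀ x ∈ Set.Icc 0 T, v x = 0 :=
    Measure.eqOn_Icc_of_ae_eq volume hT.ne hv h.continuousOn_deriv continuousOn_const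
  exact key w (h.intervalIntegrable hTm) fun x hx => by
    have := h.deriv_eq_integral x hx
    rwa [hv0 x hx, hv0 0 h0m, zero_add, eq_comm] at this

end IsPeriodicH2

/-- The graph of `-d²/dx² + V` on `L²[0,T]` with periodic boundary conditions: the pairs
`(u, -u'' + V u)` with `u ∈ H²[0,T]` satisfying `u(T) = u(0)` and `u'(T) = u'(0)`. -/
noncomputable def periodicSchrodingerGraph (T : ℝ) (V : ℝ → ℝ) :
    Submodule ℂ (L2Period T × L2Period T) where
  carrier := {p | ∃ u v w : ℝ → ℂ, IsPeriodicH2 T u v w ∧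
    p.1 =ᵐ[volume.restrict (Set.Icc (0 : ℝ) T)] u ∧
    p.2 =ᵐ[volume.restrict (Set.Icc (0 : ℝ) T)] fun x => -w x + (V x : ℂ) * u x}
  zero_mem' := by
    refine ⟨0, 0, 0, IsPeriodicH2.zero T, Lp.coeFn_zero _ _ _, ?_⟩
    filter_upwards [Lp.coeFn_zero ℂ 2 (volume.restrict (Set.Icc (0 : ℝ) T))] with x hx
    simpa using hx
  add_mem' := by
    rintro p q ⟨u, v, w, h, h1, h2⟩ ⟨u', v', w', h', h1', h2'⟩
    refine ⟨_, _, _, h.add h', ?_, ?_⟩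
    · filter_upwards [Lp.coeFn_add p.1 q.1, h1, h1'] with x hx a b
      simpa [a, b] using hx
    · filter_upwards [Lp.coeFn_add p.2 q.2, h2, h2'] with x hx a b
      simp only [Prod.snd_add, hx, Pi.add_apply, a, b]
      ring
  smul_mem' := by
    rintro c p ⟨u, v, w, h, h1, h2⟩
    refine ⟨_, _, _, h.smul c, ?_, ?_⟩
    · filter_upwards [Lp.coeFn_smul c p.1, h1] with x hx a
      simpa [a] using hx
    · filter_upwards [Lp.coeFn_smul c p.2, h2] with x hx a
      simp only [Prod.smul_snd, hx, Pi.smul_apply, a, smul_eq_mul]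
      ring

/-- The Schrödinger operator `-d²/dx² + V` on `L²[0,T]` with periodic boundary conditions, as an
unbounded operator. -/
noncomputable def periodicSchrodinger (T : ℝ) (V : ℝ → ℝ) : L2Period T →ₗ.[ℂ] L2Period T :=
  (periodicSchrodingerGraph T V).toLinearPMap

theorem periodicSchrodinger_graph (T : ℝ) (V : ℝ → ℝ) :
    (periodicSchrodinger T V).graph = periodicSchrodingerGraph T V := by
  refine Submodule.toLinearPMap_graph_eq _ ?_
  rintro p ⟨u, v, w, h, h1, h2⟩ hp
  have hu : u =ᵐ[volume.restrict (Set.Icc (0 : ℝ) T)] 0 := by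
    rw [hp] at h1
    exact h1.symm.trans (Lp.coeFn_zero _ _ _)
  refine Lp.ext ?_
  filter_upwards [h2, hu, h.ae_eq_zero hu, Lp.coeFn_zero ℂ 2 (volume.restrict (Set.Icc (0 : ℝ) T))]
    with x a b c d
  rw [a, b, c, d]
  simp

section Eigenvalues

variable {H : Type*} [AddCommGroup H] [Module ℂ H]

/-- The eigenspace `{f ∈ dom A : A f = μ f}` of an unbounded operator `A`. -/
def LinearPMap.eigenspace (A : H →ₗ.[ℂ] H) (μ : ℂ) : Submodule ℂ H :=
  (LinearMap.ker (A.toFun - μ • A.domain.subtype)).map A.domain.subtype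

/-- The `n`-th eigenvalue (`n ≥ 1`) of `A`, in increasing order and counted with multiplicity: the
least real `E` such that the eigenspaces with eigenvalue at most `E` span a space of dimension at
least `n`. -/
noncomputable def LinearPMap.nthEigenvalue (A : H →ₗ.[ℂ] H) (n : ℕ) : ℝ :=
  sInf {E : ℝ | n ≤ Module.finrank ℂ ↥(⨆ μ : ℝ, ⨆ _ : μ ≤ E, A.eigenspace (μ : ℂ))}

/-- `E 1 ≤ E 2 ≤ ⋯` lists all eigenvalues of `A`, each one as often as its (finite) multiplicity
says. -/
structure LinearPMap.IsEigenvalueEnumeration (A : H →ₗ.[ℂ] H) (E : ℕ → ℝ) : Prop where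
  mono : ∀ m n : ℕ, 1 ≤ m → m ≤ n → E m ≤ E n
  finiteDimensional : ∀ μ : ℂ, FiniteDimensional ℂ (A.eigenspace μ)
  multiplicity : ∀ μ : ℂ,
    {n : ℕ | 1 ≤ n ∧ (E n : ℂ) = μ}.encard = Module.finrank ℂ (A.eigenspace μ)

end Eigenvalues

/-- `E_{n,V}`: the `n`-th eigenvalue (`n ≥ 1`) of `-d²/dx² + V` on `L²[0,T]` with periodic boundary
conditions. -/
noncomputable def periodicEigenvalue (T : ℝ) (V : ℝ → ℝ) (n : ℕ) : ℝ :=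
  (periodicSchrodinger T V).nthEigenvalue n

/-! The proof compares quadratic forms and applies the min-max principle. Write `N` and `K` for the
L² norms of u and u' on the period. The form of -d²/dx² + W at u is K² + ∫ W|u|². The Sobolev
inequality √T·sup|u| ≤ N + TK and Cauchy–Schwarz give |∫ W|u|²| ≤ ‖W‖ N (N + TK)
(`IsPeriodicH2.abs_integral_mul_sq_le`).

With W = V this bounds the form below by -(Q + T²Q²)N² (`le_form`). It also shows that where the
form is at most E N², N + TK is at most (2 + 2T²Q + T√|E|)N (`kinetic_le`). With W = V' - V it
bounds the change of the form. The eigenvectors of the first operator up to its n-th eigenvalue,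
used as test space for the second, then give a one-sided comparison (`periodicEigenvalue_le_add`).
Exchanging the potentials gives the other side, with √|E| taken at the wrong eigenvalue; the lower
bound repairs this.

Min-max needs an orthonormal eigenbasis, hence a compact resolvent. Multiplication by V ∈ L² need
not be bounded on L², but it is bounded from continuous functions to L². The explicit problem -u'' +
u(0) = g has a solution operator that is compact into continuous functions, so it inverts -d²/dx² +
V + c up to a compact error, and the Fredholm alternative removes the error
(`exists_compact_resolvent`). The spectral theorem for compact symmetric operators does the rest. -/

open scoped BoundedContinuousFunction ComplexConjugate InnerProductSpace

/-! ### Listing in increasing order a real family with finite sublevel sets. -/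

section Counting

variable {ι : Type*} {l : ι → ℝ}

theorem exists_max_of_le (hl : ∀ E, {i | l i ≤ E}.Finite) {s : Set ι} {E : ℝ}
    (hs : s ⊆ {i | l i ≤ E}) (hne : s.Nonempty) : ∃ j ∈ s, s ⊆ {i | l i ≤ l j} := by
  obtain ⟨j, hj, h⟩ := Set.exists_max_image s l ((hl E).subset hs) hne
  exact ⟨j, hj, fun i hi => h i hi⟩

theorem nonempty_of_one_le_ncard {s : Set ι} {n : ℕ} (hn : 1 ≤ n) (h : n ≤ s.ncard) :
    s.Nonempty := by
  rw [Set.nonempty_iff_ne_empty]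
  rintro rfl
  simp at h
  omega

/-- The counting function jumps only at members of the family, so the infimum can be sought among
the finitely many values below the maximum of some n chosen members. `Infinite ι` supplies these n
members. -/
theorem exists_isLeast_le_ncard (hl : ∀ E, {i | l i ≤ E}.Finite) [Infinite ι] {n : ℕ}
    (hn : 1 ≤ n) : ∃ E, IsLeast {E : ℝ | n ≤ {i | l i ≤ E}.ncard} E := by
  obtain ⟨t, ht⟩ := Infinite.exists_subset_card_eq ι n
  have htne : (t : Set ι).Nonempty := by
    rw [Finset.coe_nonempty, ← Finset.card_pos]; omega
  obtain ⟨j, -, hj⟩ := Set.exists_max_image (t : Set ι) l t.finite_toSet htne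
  have hnj : n ≤ {i | l i ≤ l j}.ncard := by
    rw [← ht, ← Set.ncard_coe_finset]
    exact Set.ncard_le_ncard (fun i hi => hj i hi) (hl _)
  obtain ⟨k, ⟨hk1, hk2⟩, hkmin⟩ :=
    Set.exists_min_image {k | l k ≤ l j ∧ n ≤ {i | l i ≤ l k}.ncard} l
      ((hl (l j)).subset fun i hi => hi.1) ⟨j, le_rfl, hnj⟩
  refine ⟨l k, hk2, fun E hE => ?_⟩
  obtain ⟨m, hm, hm'⟩ := exists_max_of_le hl subset_rfl (nonempty_of_one_le_ncard hn hE)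
  have hnm : n ≤ {i | l i ≤ l m}.ncard := le_trans hE (Set.ncard_le_ncard hm' (hl _))
  rcases le_total (l m) (l j) with h | h
  · exact (hkmin m ⟨h, hnm⟩).trans hm
  · exact hk1.trans (h.trans hm)

/-- The `n`-th element of the family `l` in increasing order is at most `x` iff at least `n`
members of the family are. -/
theorem sInf_le_ncard_le_iff (hl : ∀ E, {i | l i ≤ E}.Finite) [Infinite ι] {n : ℕ} (hn : 1 ≤ n)
    (x : ℝ) : sInf {E : ℝ | n ≤ {i | l i ≤ E}.ncard} ≤ x ↔ n ≤ {i | l i ≤ x}.ncard := by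
  obtain ⟨E, hE⟩ := exists_isLeast_le_ncard hl hn
  rw [hE.csInf_eq]
  refine ⟨fun h => hE.1.trans (Set.ncard_le_ncard (fun i hi => le_trans hi h) (hl _)),
    fun h => hE.2 h⟩

theorem sInf_le_ncard_lt_iff (hl : ∀ E, {i | l i ≤ E}.Finite) [Infinite ι] {n : ℕ} (hn : 1 ≤ n)
    (x : ℝ) : sInf {E : ℝ | n ≤ {i | l i ≤ E}.ncard} < x ↔ n ≤ {i | l i < x}.ncard := by
  have hlt : {i | l i < x}.Finite := (hl x).subset fun i (hi : l i < x) => hi.le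
  constructor
  · intro h
    exact ((sInf_le_ncard_le_iff hl hn _).1 le_rfl).trans
      (Set.ncard_le_ncard (fun i hi => lt_of_le_of_lt hi h) hlt)
  · intro h
    obtain ⟨j, hj, hj'⟩ := exists_max_of_le hl (fun i (hi : l i < x) => hi.le)
      (nonempty_of_one_le_ncard hn h)
    exact ((sInf_le_ncard_le_iff hl hn (l j)).2
      (h.trans (Set.ncard_le_ncard hj' (hl _)))).trans_lt hj

theorem encard_sInf_le_ncard_eq (hl : ∀ E, {i | l i ≤ E}.Finite) [Infinite ι] (x : ℝ) :
    {n : ℕ | 1 ≤ n ∧ sInf {E : ℝ | n ≤ {i | l i ≤ E}.ncard} = x}.encard =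
      {i | l i = x}.ncard := by
  have hlt : {i | l i < x}.Finite := (hl x).subset fun i (hi : l i < x) => hi.le
  have heq : {i | l i = x}.Finite := (hl x).subset fun i (hi : l i = x) => hi.le
  -- The positions holding the value x are those after all smaller members, up to the last member
  -- equal to x.
  have h1 : {n : ℕ | 1 ≤ n ∧ sInf {E : ℝ | n ≤ {i | l i ≤ E}.ncard} = x} =
      (Finset.Ioc {i | l i < x}.ncard {i | l i ≤ x}.ncard : Finset ℕ) := by
    ext n
    simp only [Set.mem_ofPred_eq, Finset.coe_Ioc, Set.mem_Ioc]
    constructor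
    · rintro ⟨hn, h⟩
      refine ⟨?_, (sInf_le_ncard_le_iff hl hn x).1 h.le⟩
      by_contra hc
      exact h.not_lt ((sInf_le_ncard_lt_iff hl hn x).2 (not_lt.1 hc))
    · rintro ⟨h2, h3⟩
      have hn : 1 ≤ n := by omega
      refine ⟨hn, le_antisymm ((sInf_le_ncard_le_iff hl hn x).2 h3) ?_⟩
      by_contra hc
      exact absurd ((sInf_le_ncard_lt_iff hl hn x).1 (not_le.1 hc)) (not_le.2 h2)
  have h2 : {i | l i ≤ x}.ncard = {i | l i < x}.ncard + {i | l i = x}.ncard := by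
    rw [← Set.ncard_union_eq (Set.disjoint_left.2 fun i hi hi' => hi.ne hi') hlt heq]
    congr 1
    ext i
    exact le_iff_lt_or_eq (a := l i) (b := x)
  rw [h1, Set.encard_coe_eq_coe_finsetCard, Nat.card_Ioc, h2, Nat.add_sub_cancel_left]

end Counting

/-! ### Diagonalized operators and the min-max principle. -/

namespace LinearPMap

section Graph

variable {H : Type*} [AddCommGroup H] [Module ℂ H]

theorem mem_eigenspace_iff {A : H →ₗ.[ℂ] H} {μ : ℂ} {x : H} :
    x ∈ A.eigenspace μ ↔ (x, μ • x) ∈ A.graph := by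
  simp only [eigenspace, Submodule.mem_map, LinearMap.mem_ker, LinearPMap.mem_graph_iff]
  constructor
  · rintro ⟨y, hy, rfl⟩
    exact ⟨y, rfl, sub_eq_zero.1 hy⟩
  · rintro ⟨y, hy, h⟩
    refine ⟨y, ?_, hy⟩
    exact sub_eq_zero.2 (h.trans (congrArg (μ • ·) hy.symm))

end Graph

variable {H : Type*} [NormedAddCommGroup H] [InnerProductSpace ℂ H]

/-- A symmetric operator with an orthonormal basis of eigenvectors, the eigenvalues accumulating
only at `+∞`. -/
structure IsDiagonalizedBy {ι : Type*} (A : H →ₗ.[ℂ] H) (b : HilbertBasis ι ℂ H) (l : ι → ℝ) :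
    Prop where
  symm : ∀ p ∈ A.graph, ∀ q ∈ A.graph, ⟪p.1, q.2⟫_ℂ = ⟪p.2, q.1⟫_ℂ
  mem_graph : ∀ i, (b i, (l i : ℂ) • b i) ∈ A.graph
  finite : ∀ E, {i | l i ≤ E}.Finite

namespace IsDiagonalizedBy

variable {ι : Type*} {A : H →ₗ.[ℂ] H} {b : HilbertBasis ι ℂ H} {l : ι → ℝ}

theorem inner_snd (h : A.IsDiagonalizedBy b l) {p : H × H} (hp : p ∈ A.graph) (i : ι) :
    ⟪b i, p.2⟫_ℂ = l i * ⟪b i, p.1⟫_ℂ := by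
  rw [h.symm _ (h.mem_graph i) _ hp, inner_smul_left, Complex.conj_ofReal]

/-- By symmetry an eigenvector x satisfies (l i - μ)⟪b i, x⟫ = 0, so its basis expansion reduces to
the finitely many terms with l i = μ. -/
theorem eigenspace_eq_span (h : A.IsDiagonalizedBy b l) (μ : ℂ) :
    A.eigenspace μ = Submodule.span ℂ (b '' {i | (l i : ℂ) = μ}) := by
  refine le_antisymm (fun x hx => ?_) (Submodule.span_le.2 ?_)
  · rw [mem_eigenspace_iff] at hx
    have hfin : {i | (l i : ℂ) = μ}.Finite :=
      (h.finite μ.re).subset fun i hi => by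
        simp only [Set.mem_ofPred_eq] at hi ⊢
        rw [← hi, Complex.ofReal_re]
    have h0 : ∀ i ∉ hfin.toFinset, (b.repr x i) • b i = 0 := by
      intro i hi
      rw [Set.Finite.mem_toFinset, Set.mem_ofPred_eq] at hi
      have := h.inner_snd hx i
      simp only [inner_smul_right] at this
      rw [b.repr_apply_apply]
      have h2 : ((l i : ℂ) - μ) * ⟪b i, x⟫_ℂ = 0 := by rw [sub_mul, this, sub_self]
      rw [(mul_eq_zero.1 h2).resolve_left (sub_ne_zero.2 hi), zero_smul]
    rw [(b.hasSum_repr x).unique (hasSum_sum_of_ne_finset_zero h0)]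
    refine Submodule.sum_mem _ fun i hi => Submodule.smul_mem _ _ (Submodule.subset_span ?_)
    exact ⟨i, by simpa using hi, rfl⟩
  · rintro _ ⟨i, hi, rfl⟩
    rw [SetLike.mem_coe, mem_eigenspace_iff, ← (show (l i : ℂ) = μ from hi)]
    exact h.mem_graph i

theorem iSup_eigenspace_eq_span (h : A.IsDiagonalizedBy b l) (E : ℝ) :
    ⨆ μ : ℝ, ⨆ _ : μ ≤ E, A.eigenspace (μ : ℂ) = Submodule.span ℂ (b '' {i | l i ≤ E}) := by
  simp only [h.eigenspace_eq_span, ← Submodule.span_iUnion, ← Set.image_iUnion]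
  congr 2
  ext i
  simp

theorem finrank_span_image (b : HilbertBasis ι ℂ H) {s : Set ι} (hs : s.Finite) :
    Module.finrank ℂ (Submodule.span ℂ (b '' s)) = s.ncard := by
  have hli : LinearIndependent ℂ fun i : s => b i :=
    b.orthonormal.linearIndependent.comp _ Subtype.val_injective
  have := hs.fintype
  rw [Set.image_eq_range, finrank_span_eq_card hli, Set.ncard_eq_toFinset_card',
    Set.toFinset_card]

theorem nthEigenvalue_eq (h : A.IsDiagonalizedBy b l) (n : ℕ) :
    A.nthEigenvalue n = sInf {E : ℝ | n ≤ {i | l i ≤ E}.ncard} := by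
  have hE : ∀ E : ℝ, Module.finrank ℂ ↥(⨆ μ : ℝ, ⨆ _ : μ ≤ E, A.eigenspace (μ : ℂ)) =
      {i | l i ≤ E}.ncard := fun E => by
    rw [h.iSup_eigenspace_eq_span, finrank_span_image b (h.finite _)]
  simp only [nthEigenvalue, hE]

theorem nthEigenvalue_le_iff (h : A.IsDiagonalizedBy b l) [Infinite ι] {n : ℕ} (hn : 1 ≤ n)
    (x : ℝ) : A.nthEigenvalue n ≤ x ↔ n ≤ {i | l i ≤ x}.ncard := by
  rw [h.nthEigenvalue_eq, sInf_le_ncard_le_iff h.finite hn]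

theorem isEigenvalueEnumeration (h : A.IsDiagonalizedBy b l) [Infinite ι] :
    A.IsEigenvalueEnumeration A.nthEigenvalue where
  mono m n hm hmn := by
    rw [h.nthEigenvalue_le_iff hm]
    exact hmn.trans ((h.nthEigenvalue_le_iff (hm.trans hmn) _).1 le_rfl)
  finiteDimensional μ := by
    rw [h.eigenspace_eq_span]
    refine FiniteDimensional.span_of_finite ℂ (Set.Finite.image _ ?_)
    refine (h.finite μ.re).subset fun i hi => ?_
    simp only [Set.mem_ofPred_eq] at hi ⊢
    rw [← hi, Complex.ofReal_re]
  multiplicity μ := by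
    by_cases hμ : ∃ x : ℝ, (x : ℂ) = μ
    · obtain ⟨x, rfl⟩ := hμ
      have h1 : {i | (l i : ℂ) = x} = {i | l i = x} := by simp only [Complex.ofReal_inj]
      have h2 : {i | l i = x}.Finite := (h.finite x).subset fun i (hi : l i = x) => hi.le
      rw [h.eigenspace_eq_span, h1, finrank_span_image b h2]
      simp only [h.nthEigenvalue_eq, Complex.ofReal_inj]
      exact encard_sInf_le_ncard_eq h.finite x
    · push Not at hμ
      have h1 : {n : ℕ | 1 ≤ n ∧ (A.nthEigenvalue n : ℂ) = μ} = ∅ :=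
        Set.eq_empty_of_forall_notMem fun n hn => hμ _ hn.2
      have h2 : {i | (l i : ℂ) = μ} = ∅ :=
        Set.eq_empty_of_forall_notMem fun n hn => hμ _ hn
      rw [h1, h.eigenspace_eq_span, h2, Set.image_empty, Submodule.span_empty, finrank_bot,
        Set.encard_empty, Nat.cast_zero]

theorem hasSum_norm_inner_sq (b : HilbertBasis ι ℂ H) (x : H) :
    HasSum (fun i => ‖⟪b i, x⟫_ℂ‖ ^ 2) (‖x‖ ^ 2) := by
  have h1 := Complex.hasSum_re (b.hasSum_inner_mul_inner x x)
  rw [inner_self_eq_norm_sq_to_K] at h1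
  convert h1 using 1
  · ext i
    rw [← inner_conj_symm x (b i), ← Complex.normSq_eq_conj_mul_self, Complex.ofReal_re,
      Complex.normSq_eq_norm_sq]
  · norm_cast

/-- Parseval's identity for the pair `p.1`, `p.2`, combined with `inner_snd`; summability comes with
it. -/
theorem hasSum_form (h : A.IsDiagonalizedBy b l) {p : H × H} (hp : p ∈ A.graph) :
    HasSum (fun i => l i * ‖⟪b i, p.1⟫_ℂ‖ ^ 2) (⟪p.1, p.2⟫_ℂ).re := by
  have h1 := Complex.hasSum_re (b.hasSum_inner_mul_inner p.1 p.2)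
  convert h1 using 1
  ext i
  rw [h.inner_snd hp, mul_left_comm, ← inner_conj_symm p.1 (b i),
    ← Complex.normSq_eq_conj_mul_self, Complex.re_ofReal_mul, Complex.ofReal_re,
      Complex.normSq_eq_norm_sq]

theorem form_le_of_mem_span (h : A.IsDiagonalizedBy b l) {p : H × H} (hp : p ∈ A.graph) {E : ℝ}
    (hE : p.1 ∈ Submodule.span ℂ (b '' {i | l i ≤ E})) :
    (⟪p.1, p.2⟫_ℂ).re ≤ E * ‖p.1‖ ^ 2 := by
  refine hasSum_le (fun i => ?_) (h.hasSum_form hp) ((hasSum_norm_inner_sq b p.1).mul_left E)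
  by_cases hi : l i ≤ E
  · gcongr
  · have h0 : ⟪b i, p.1⟫_ℂ = 0 := by
      refine Submodule.span_induction (p := fun x _ => ⟪b i, x⟫_ℂ = 0) ?_ (inner_zero_right _)
        (fun x y _ _ hx hy => by rw [inner_add_right, hx, hy, add_zero])
        (fun c x _ hx => by rw [inner_smul_right, hx, mul_zero]) hE
      rintro _ ⟨j, hj, rfl⟩
      exact b.orthonormal.2 fun hij => hi (hij ▸ hj)
    simp [h0]

/-- Compare the two Parseval series termwise. A nonzero vector has a nonzero coefficient,
necessarily at some l i > E, and this makes the inequality strict, as the min-max contradiction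
requires. -/
theorem lt_form_of_orthogonal (h : A.IsDiagonalizedBy b l) {p : H × H} (hp : p ∈ A.graph) {E : ℝ}
    (hE : ∀ i, l i ≤ E → ⟪b i, p.1⟫_ℂ = 0) (hne : p.1 ≠ 0) :
    E * ‖p.1‖ ^ 2 < (⟪p.1, p.2⟫_ℂ).re := by
  have hterm : ∀ i, E * ‖⟪b i, p.1⟫_ℂ‖ ^ 2 ≤ l i * ‖⟪b i, p.1⟫_ℂ‖ ^ 2 := fun i => by
    by_cases hi : l i ≤ E
    · simp [hE i hi]
    · gcongr
      exact (not_le.1 hi).le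
  obtain ⟨i, hi⟩ : ∃ i, ⟪b i, p.1⟫_ℂ ≠ 0 := by
    by_contra hc
    push Not at hc
    have := hasSum_norm_inner_sq b p.1
    simp only [hc, norm_zero, ne_eq, OfNat.ofNat_ne_zero, not_false_eq_true, zero_pow] at this
    exact hne (norm_eq_zero.1 (pow_eq_zero_iff two_ne_zero |>.1 (this.unique hasSum_zero)))
  refine hasSum_lt hterm (i := i) ?_ ((hasSum_norm_inner_sq b p.1).mul_left E) (h.hasSum_form hp)
  have : E < l i := by
    by_contra hc
    exact hi (hE i (not_lt.1 hc))
  have := norm_pos_iff.2 hi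
  gcongr

/-- Upper bound in the min-max principle. -/
theorem nthEigenvalue_le_of_form_le (h : A.IsDiagonalizedBy b l) [Infinite ι] {n : ℕ} (hn : 1 ≤ n)
    {E : ℝ} (W : Submodule ℂ H) [FiniteDimensional ℂ W] (hW : n ≤ Module.finrank ℂ W)
    (hform : ∀ x ∈ W, ∃ y, (x, y) ∈ A.graph ∧ (⟪x, y⟫_ℂ).re ≤ E * ‖x‖ ^ 2) :
    A.nthEigenvalue n ≤ E := by
  rw [h.nthEigenvalue_le_iff hn]
  refine hW.trans ?_
  by_contra hc
  have := (h.finite E).fintype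
  -- If fewer than n eigenvalues were at most E, these coefficient functionals would have a common
  -- nonzero zero in `W`: a vector orthogonal to all low eigenvectors.
  let f : W →ₗ[ℂ] ({i | l i ≤ E} → ℂ) :=
    LinearMap.pi fun i => (innerSL ℂ (b i)).toLinearMap ∘ₗ W.subtype
  have hker := LinearMap.ker_ne_bot_of_finrank_lt (f := f) (by
    rw [Module.finrank_fintype_fun_eq_card, ← Set.toFinset_card, ← Set.ncard_eq_toFinset_card']
    exact not_le.1 hc)
  obtain ⟨x, hx, hx0⟩ := (Submodule.ne_bot_iff _).1 hker
  obtain ⟨y, hy, hxy⟩ := hform x x.2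
  refine (h.lt_form_of_orthogonal hy (E := E) (fun i hi => ?_) ?_).not_ge hxy
  · exact congrFun (LinearMap.mem_ker.1 hx) ⟨i, hi⟩
  · simpa using hx0

/-- The eigenvectors up to the `n`-th eigenvalue span a test space for the min-max principle. -/
theorem exists_finrank_ge (h : A.IsDiagonalizedBy b l) [Infinite ι] {n : ℕ} (hn : 1 ≤ n) :
    ∃ W : Submodule ℂ H, FiniteDimensional ℂ W ∧ n ≤ Module.finrank ℂ W ∧
      ∀ x ∈ W, ∃ y, (x, y) ∈ A.graph ∧ (⟪x, y⟫_ℂ).re ≤ A.nthEigenvalue n * ‖x‖ ^ 2 := by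
  refine ⟨Submodule.span ℂ (b '' {i | l i ≤ A.nthEigenvalue n}),
    FiniteDimensional.span_of_finite ℂ ((h.finite _).image _), ?_, fun x hx => ?_⟩
  · rw [finrank_span_image b (h.finite _)]
    exact (h.nthEigenvalue_le_iff hn _).1 le_rfl
  · obtain ⟨y, hy⟩ : ∃ y, (x, y) ∈ A.graph := by
      have hle : Submodule.span ℂ (b '' {i | l i ≤ A.nthEigenvalue n}) ≤ A.domain := by
        refine Submodule.span_le.2 ?_
        rintro _ ⟨i, -, rfl⟩
        exact A.mem_domain_of_mem_graph (h.mem_graph i)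
      exact ⟨A ⟨x, hle hx⟩, A.mem_graph ⟨x, hle hx⟩⟩
    exact ⟨y, hy, h.form_le_of_mem_span hy hx⟩

end IsDiagonalizedBy

end LinearPMap

/-! ### The spectral theorem for operators with compact resolvent. -/

namespace LinearPMap

variable {H : Type*} [NormedAddCommGroup H] [InnerProductSpace ℂ H]

/-- Only finitely many orthonormal eigenvectors of a compact operator have eigenvalue at least
`ε > 0`. -/
theorem _root_.IsCompactOperator.finite_setOf_le {ι : Type*} {R : H →L[ℂ] H}
    (hR : IsCompactOperator R) {e : ι → H} (he : Orthonormal ℂ e) {r : ι → ℝ}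
    (hr : ∀ i, R (e i) = (r i : ℂ) • e i) {ε : ℝ} (hε : 0 < ε) : {i | ε ≤ r i}.Finite := by
  by_contra hinf
  let f := Set.Infinite.natEmbedding _ hinf
  obtain ⟨K, hK, hK'⟩ := hR.image_closedBall_subset_compact 1
  obtain ⟨y, -, φ, hφ, hy⟩ := hK.tendsto_subseq (x := fun n => R (e (f n)))
    (fun n => hK' ⟨e (f n), by simp [he.1], rfl⟩)
  obtain ⟨N, hN⟩ := Metric.cauchySeq_iff'.1 hy.cauchySeq ε hε
  have h1 := hN (N + 1) (Nat.le_succ N)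
  have hne : (f (φ (N + 1)) : ι) ≠ f (φ N) := fun h => by
    have := hφ.injective (f.injective (Subtype.ext h))
    omega
  refine absurd h1 (not_lt.2 ?_)
  -- The images of distinct eigenvectors are ε-separated: the component of their difference along
  -- the first eigenvector is its eigenvalue.
  calc ε ≤ r (f (φ (N + 1))) := (f (φ (N + 1))).2
    _ ≤ ‖⟪e (f (φ (N + 1))), R (e (f (φ (N + 1)))) - R (e (f (φ N)))⟫_ℂ‖ := by
        rw [inner_sub_right, hr, hr, inner_smul_right, inner_smul_right, he.2 hne,
          inner_self_eq_norm_sq_to_K, he.1]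
        simp [le_abs_self]
    _ ≤ _ := by
        refine (norm_inner_le_norm _ _).trans ?_
        rw [he.1, one_mul, Function.comp_apply, Function.comp_apply, dist_eq_norm]

/-- A symmetric operator bounded below with compact resolvent has an orthonormal basis of
eigenvectors. -/
theorem exists_isDiagonalizedBy [CompleteSpace H] {A : H →ₗ.[ℂ] H}
    (hsymm : ∀ p ∈ A.graph, ∀ q ∈ A.graph, ⟪p.1, q.2⟫_ℂ = ⟪p.2, q.1⟫_ℂ) {m c : ℝ} (hmc : m < c)
    (hlow : ∀ p ∈ A.graph, -m * ‖p.1‖ ^ 2 ≤ (⟪p.1, p.2⟫_ℂ).re) {R : H →L[ℂ] H}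
    (hR : IsCompactOperator R) (hRA : ∀ f, (R f, f - (c : ℂ) • R f) ∈ A.graph) :
    ∃ (ι : Type) (b : HilbertBasis ι ℂ H) (l : ι → ℝ), A.IsDiagonalizedBy b l := by
  have hRs : (R : H →ₗ[ℂ] H).IsSymmetric := fun f g => by
    have := hsymm _ (hRA f) _ (hRA g)
    simp only [inner_sub_left, inner_sub_right, inner_smul_left, inner_smul_right,
      Complex.conj_ofReal, sub_left_inj] at this
    exact this
  -- `A.graph` is single-valued, and R f = 0 puts (0, f) in it. So 0 is not an eigenvalue of `R`.
  have hker : ∀ f, R f = 0 → f = 0 := fun f hf => by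
    have := hRA f
    rw [hf, smul_zero, sub_zero] at this
    exact A.graph_fst_eq_zero_snd this rfl
  have hfd : ∀ μ : ℂ, FiniteDimensional ℂ (Module.End.eigenspace (R : H →ₗ[ℂ] H) μ) := fun μ => by
    rcases eq_or_ne μ 0 with rfl | hμ
    · have : Module.End.eigenspace (R : H →ₗ[ℂ] H) 0 = ⊥ := by
        rw [Module.End.eigenspace_zero, LinearMap.ker_eq_bot']
        exact hker
      rw [this]
      infer_instance
    · exact R.finite_dimensional_eigenspace hR μ hμ
  -- All complex μ are allowed as labels; those that are not eigenvalues contribute the empty type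
  -- `Fin 0`.
  let e : (Σ μ : ℂ, Fin (Module.finrank ℂ (Module.End.eigenspace (R : H →ₗ[ℂ] H) μ))) → H :=
    fun i => (stdOrthonormalBasis ℂ (Module.End.eigenspace (R : H →ₗ[ℂ] H) i.1) i.2 : H)
  have he : Orthonormal ℂ e :=
    hRs.orthogonalFamily_eigenspaces.orthonormal_sigma_orthonormal
      fun μ => (stdOrthonormalBasis ℂ _).orthonormal
  have hspan : (Submodule.span ℂ (Set.range e))ᗮ = ⊥ := by
    rw [eq_bot_iff, ← R.orthogonalComplement_iSup_eigenspaces_eq_bot hR hRs]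
    refine Submodule.orthogonal_le (iSup_le fun μ => ?_)
    have h1 := (stdOrthonormalBasis ℂ (Module.End.eigenspace (R : H →ₗ[ℂ] H) μ)).toBasis.span_eq
    have h2 := congrArg (Submodule.map (Module.End.eigenspace (R : H →ₗ[ℂ] H) μ).subtype) h1
    rw [Submodule.map_span, Submodule.map_top, Submodule.range_subtype] at h2
    rw [← h2]
    refine Submodule.span_mono ?_
    rintro _ ⟨_, ⟨k, rfl⟩, rfl⟩
    exact ⟨⟨μ, k⟩, by simp [e]⟩
  have heig : ∀ i, R (e i) = i.1 • e i := fun i =>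
    Module.End.mem_eigenspace_iff.1
      (stdOrthonormalBasis ℂ (Module.End.eigenspace (R : H →ₗ[ℂ] H) i.1) i.2).2
  have hne : ∀ i, e i ≠ 0 := fun i => he.ne_zero i
  have hreal : ∀ i : Σ μ : ℂ, Fin (Module.finrank ℂ (Module.End.eigenspace (R : H →ₗ[ℂ] H) μ)),
      ((i.1.re : ℝ) : ℂ) = i.1 := fun i =>
    Complex.conj_eq_iff_re.1 (hRs.conj_eigenvalue_eq_self
      (Module.End.hasEigenvalue_of_hasEigenvector ⟨Module.End.mem_eigenspace_iff.2 (heig i), hne i⟩))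
  have heig' : ∀ i, R (e i) = ((i.1.re : ℝ) : ℂ) • e i := fun i => by rw [hreal, heig]
  -- For an eigenvalue r of `R`, the lower bound at R e = r e reads -m r² ≤ r - c r², so r ≥ (c - m)
  -- r² > 0.
  have hpos : ∀ i : Σ μ : ℂ, Fin (Module.finrank ℂ (Module.End.eigenspace (R : H →ₗ[ℂ] H) μ)),
      0 < i.1.re := fun i => by
    have h1 := hlow _ (hRA (e i))
    have h2 : i.1.re ≠ 0 := fun h => hne i (hker _ (by rw [heig', h]; simp))
    simp only [heig', inner_sub_right, inner_smul_left, inner_smul_right, norm_smul, he.1,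
      inner_self_eq_norm_sq_to_K, Complex.conj_ofReal] at h1
    norm_num at h1
    have h3 : 0 < i.1.re ^ 2 := by positivity
    have h4 : (((|i.1.re| : ℝ) : ℂ) ^ 2).re = i.1.re ^ 2 := by
      rw [← Complex.ofReal_pow, Complex.ofReal_re, sq_abs]
    rw [h4] at h1
    have h5 := mul_pos (sub_pos.2 hmc) h3
    linarith
  -- An eigenvalue r of `R` corresponds to 1/r - c for `A`. A value at most E means r ≥ 1/(E + c)
  -- when E + c > 0, and is impossible otherwise since r > 0.
  refine ⟨_, HilbertBasis.mkOfOrthogonalEqBot he hspan, fun i => (i.1.re)⁻¹ - c, hsymm,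
    fun i => ?_, fun E => ?_⟩
  · rw [HilbertBasis.coe_mkOfOrthogonalEqBot]
    have h1 := A.graph.smul_mem ((i.1.re : ℂ)⁻¹) (hRA (e i))
    have h2 : (i.1.re : ℂ) ≠ 0 := by exact_mod_cast (hpos i).ne'
    rw [heig', Prod.smul_mk, smul_smul, inv_mul_cancel₀ h2, one_smul, smul_sub, smul_smul,
      smul_smul, mul_right_comm, inv_mul_cancel₀ h2, one_mul, ← sub_smul] at h1
    push_cast
    exact h1
  · by_cases hE : 0 < E + c
    · refine (hR.finite_setOf_le he heig' (inv_pos.2 hE)).subset fun i (hi : _ ≤ E) => ?_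
      exact inv_le_of_inv_le₀ (hpos i) (by linarith)
    · refine Set.finite_empty.subset fun i (hi : _ ≤ E) => ?_
      have := inv_pos.2 (hpos i)
      exact absurd hi (by linarith)

end LinearPMap

/-! ### Integration by parts for absolutely continuous functions. -/

section IntegrationByParts

theorem absolutelyContinuousOnInterval_const {F : Type*} [SeminormedAddCommGroup F] (c : F)
    (a b : ℝ) : AbsolutelyContinuousOnInterval (fun _ => c) a b :=
  (LipschitzWith.const c).lipschitzOnWith.absolutelyContinuousOnInterval (K := 0)

theorem AbsolutelyContinuousOnInterval.congr {X : Type*} [PseudoMetricSpace X] {f g : ℝ → X}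
    {a b : ℝ} (hf : AbsolutelyContinuousOnInterval f a b) (h : Set.EqOn f g (Set.uIcc a b)) :
    AbsolutelyContinuousOnInterval g a b := by
  rw [absolutelyContinuousOnInterval_iff] at hf ⊢
  intro ε hε
  obtain ⟨δ, hδ, H⟩ := hf ε hε
  refine ⟨δ, hδ, fun E hE hlen => ?_⟩
  rw [Finset.sum_congr rfl fun i hi => ?_]
  · exact H E hE hlen
  · rw [h (hE.1 i hi).1, h (hE.1 i hi).2]

theorem IntervalIntegrable.absolutelyContinuousOnInterval_complex {f : ℝ → ℂ} {a b : ℝ}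
    (h : IntervalIntegrable f volume a b) :
    AbsolutelyContinuousOnInterval (fun x => ∫ t in a..x, f t) a b := by
  have hre : IntervalIntegrable (fun x => (f x).re) volume a b := ⟨h.1.re, h.2.re⟩
  have him : IntervalIntegrable (fun x => (f x).im) volume a b := ⟨h.1.im, h.2.im⟩
  refine (((hre.absolutelyContinuousOnInterval_intervalIntegral (c := a) (by simp)).smul
    (absolutelyContinuousOnInterval_const (1 : ℂ) a b)).add
    ((him.absolutelyContinuousOnInterval_intervalIntegral (c := a) (by simp)).smul
    (absolutelyContinuousOnInterval_const Complex.I a b))).congr fun x hx => ?_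
  have hx' : IntervalIntegrable f volume a x :=
    h.mono_set (Set.uIcc_subset_uIcc Set.left_mem_uIcc hx)
  have h1 := Complex.reCLM.intervalIntegral_comp_comm hx'
  have h2 := Complex.imCLM.intervalIntegral_comp_comm hx'
  simp only [Complex.reCLM_apply, Complex.imCLM_apply] at h1 h2
  simp only [Pi.add_apply, Pi.smul_apply', Complex.real_smul, h1, h2, mul_one]
  exact Complex.re_add_im _

/-- Integration by parts for absolutely continuous complex functions. -/
theorem integral_mul_add_mul_eq_sub {T : ℝ} (hT : 0 ≤ T) {F G f g : ℝ → ℂ}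
    (hf : IntervalIntegrable f volume 0 T) (hg : IntervalIntegrable g volume 0 T)
    (hF : ∀ x ∈ Set.Icc 0 T, F x = F 0 + ∫ t in (0 : ℝ)..x, f t)
    (hG : ∀ x ∈ Set.Icc 0 T, G x = G 0 + ∫ t in (0 : ℝ)..x, g t) :
    ∫ x in (0 : ℝ)..T, (f x * G x + F x * g x) = F T * G T - F 0 * G 0 := by
  set F' : ℝ → ℂ := fun x => F 0 + ∫ t in (0 : ℝ)..x, f t with hF'
  set G' : ℝ → ℂ := fun x => G 0 + ∫ t in (0 : ℝ)..x, g t with hG'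
  have hacF : AbsolutelyContinuousOnInterval F' 0 T :=
    (absolutelyContinuousOnInterval_const (F 0) 0 T).add hf.absolutelyContinuousOnInterval_complex
  have hacG : AbsolutelyContinuousOnInterval G' 0 T :=
    (absolutelyContinuousOnInterval_const (G 0) 0 T).add hg.absolutelyContinuousOnInterval_complex
  have hint : IntervalIntegrable (fun x => f x * G' x + F' x * g x) volume 0 T :=
    (hf.mul_continuousOn hacG.continuousOn).add (hg.continuousOn_mul hacF.continuousOn)
  -- The product minus the primitive of its formal derivative is absolutely continuous with
  -- derivative zero almost everywhere, hence constant; compare 0 and T.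
  have hac := (hacF.smul hacG).sub hint.absolutelyContinuousOnInterval_complex
  obtain ⟨C, hC⟩ := hac.const_of_ae_hasDerivAt_zero (by
    filter_upwards [hf.ae_hasDerivAt_integral, hg.ae_hasDerivAt_integral,
      hint.ae_hasDerivAt_integral] with x h1 h2 h3 hx
    have h : HasDerivAt (F' • G' - fun x => ∫ t in (0 : ℝ)..x, f t * G' t + F' t * g t)
        (f x * G' x + F' x * g x - (f x * G' x + F' x * g x)) x :=
      (((h1 hx 0 (by simp)).const_add (F 0)).mul
      ((h2 hx 0 (by simp)).const_add (G 0))).sub (h3 hx 0 (by simp))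
    rwa [sub_self] at h)
  have h0 := hC 0 (by simp)
  have h1 := hC T (by simp)
  have hTT := hF T ⟨hT, le_rfl⟩
  have hTT' := hG T ⟨hT, le_rfl⟩
  simp only [Pi.sub_apply, smul_eq_mul, intervalIntegral.integral_same,
    sub_zero, Pi.mul_apply] at h0 h1
  have hF0 : F' 0 = F 0 := by simp [hF']
  have hG0 : G' 0 = G 0 := by simp [hG']
  have hFT : F' T = F T := hTT.symm
  have hGT : G' T = G T := hTT'.symm
  rw [hF0, hG0] at h0
  rw [hFT, hGT, ← h0] at h1
  rw [← h1, intervalIntegral.integral_congr (g := fun x => f x * G' x + F' x * g x)]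
  · ring
  · intro x hx
    rw [Set.uIcc_of_le hT] at hx
    simp only [hF x hx, hG x hx, hF', hG']

end IntegrationByParts

/-! ### Cauchy–Schwarz and Sobolev estimates on the period. -/

section CauchySchwarz

variable {α : Type*} [MeasurableSpace α] {μ : Measure α}

theorem integral_mul_le_sqrt_mul_sqrt {f g : α → ℝ} (hf : MemLp f 2 μ) (hg : MemLp g 2 μ)
    (hf0 : ∀ x, 0 ≤ f x) (hg0 : ∀ x, 0 ≤ g x) :
    ∫ x, f x * g x ∂μ ≤ √(∫ x, f x ^ 2 ∂μ) * √(∫ x, g x ^ 2 ∂μ) := by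
  have := integral_mul_le_Lp_mul_Lq_of_nonneg (μ := μ) (p := 2) (q := 2)
    ((Real.holderConjugate_iff).2 ⟨by norm_num, by norm_num⟩)
    (ae_of_all _ hf0) (ae_of_all _ hg0) (by simpa using hf) (by simpa using hg)
  simpa only [Real.sqrt_eq_rpow, Real.rpow_two] using this

end CauchySchwarz

namespace IsPeriodicH2

variable {T : ℝ} {u v w u' v' w' : ℝ → ℂ}

theorem integral_by_parts (hT : 0 ≤ T) (h : IsPeriodicH2 T u v w) (h' : IsPeriodicH2 T u' v' w') :
    ∫ x in Set.Icc 0 T, conj (u x) * w' x = -∫ x in Set.Icc 0 T, conj (v x) * v' x := by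
  have hTm : T ∈ Set.Icc 0 T := ⟨hT, le_rfl⟩
  have hv : IntervalIntegrable (fun x => conj (v x)) volume 0 T := by
    refine ContinuousOn.intervalIntegrable ?_
    rw [Set.uIcc_of_le hT]
    exact Complex.continuous_conj.comp_continuousOn h.continuousOn_deriv
  have h1 := integral_mul_add_mul_eq_sub hT (F := fun x => conj (u x)) hv
    (h'.intervalIntegrable hTm) (fun x hx => by
      rw [h.eq_integral x hx, map_add, intervalIntegral.integral_of_le hx.1,
        intervalIntegral.integral_of_le hx.1, ← integral_conj]) h'.deriv_eq_integral
  rw [h.periodic, h'.deriv_periodic, sub_self, intervalIntegral.integral_add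
    (hv.mul_continuousOn (by rw [Set.uIcc_of_le hT]; exact h'.continuousOn_deriv))
    ((h'.intervalIntegrable hTm).continuousOn_mul (by
      rw [Set.uIcc_of_le hT]; exact Complex.continuous_conj.comp_continuousOn h.continuousOn)),
    intervalIntegral.integral_of_le hT, intervalIntegral.integral_of_le hT,
    ← integral_Icc_eq_integral_Ioc, ← integral_Icc_eq_integral_Ioc] at h1
  linear_combination h1

theorem _root_.ContinuousOn.memLp_Icc {f : ℝ → ℂ} {a b : ℝ} (hf : ContinuousOn f (Set.Icc a b)) :
    MemLp f 2 (volume.restrict (Set.Icc a b)) := by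
  obtain ⟨C, hC⟩ := isCompact_Icc.exists_bound_of_continuousOn hf
  exact MemLp.of_bound (hf.aestronglyMeasurable measurableSet_Icc) C
    ((ae_restrict_iff' measurableSet_Icc).2 (ae_of_all _ hC))

/-- Sobolev inequality on the period. -/
theorem norm_mul_sqrt_le (h : IsPeriodicH2 T u v w) {x : ℝ}
    (hx : x ∈ Set.Icc 0 T) :
    ‖u x‖ * √T ≤ √(∫ y in Set.Icc 0 T, ‖u y‖ ^ 2) + T * √(∫ y in Set.Icc 0 T, ‖v y‖ ^ 2) := by
  have hT : 0 ≤ T := hx.1.trans hx.2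
  have hvi : IntegrableOn (fun t => ‖v t‖) (Set.Icc 0 T) :=
    h.continuousOn_deriv.norm.integrableOn_Icc
  have hui : IntegrableOn (fun t => ‖u t‖) (Set.Icc 0 T) := h.continuousOn.norm.integrableOn_Icc
  have h1 : ∀ y ∈ Set.Icc 0 T, ‖u x‖ ≤ ‖u y‖ + ∫ t in Set.Icc 0 T, ‖v t‖ := fun y hy => by
    have h2 : u x - u y = ∫ t in y..x, v t := by
      rw [h.eq_integral x hx, h.eq_integral y hy, add_sub_add_left_eq_sub,
        intervalIntegral.integral_interval_sub_left (h.intervalIntegrable_deriv hx)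
        (h.intervalIntegrable_deriv hy)]
    have h3 : ‖u x - u y‖ ≤ ∫ t in Set.Icc 0 T, ‖v t‖ := by
      rw [h2]
      refine intervalIntegral.norm_integral_le_integral_norm_uIoc.trans
        (setIntegral_mono_set hvi (ae_of_all _ fun t => norm_nonneg _) ?_)
      exact (Set.uIoc_subset_uIcc.trans (Set.uIcc_subset_Icc hy hx)).eventuallyLE
    calc ‖u x‖ = ‖u y + (u x - u y)‖ := by rw [add_sub_cancel]
      _ ≤ _ := (norm_add_le _ _).trans (by gcongr)
  have hconst : ∀ c : ℝ, ∫ _ in Set.Icc 0 T, c = T * c := fun c => by simp [hT]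
  -- Integrate the pointwise bound `h1` over y; Cauchy–Schwarz against 1 then turns both L¹ norms
  -- into √T times L² norms.
  have h2 : T * ‖u x‖ ≤ (∫ y in Set.Icc 0 T, ‖u y‖) + T * ∫ t in Set.Icc 0 T, ‖v t‖ := by
    rw [← hconst, ← hconst, ← integral_add hui (integrable_const _)]
    exact setIntegral_mono_on (integrable_const _) (hui.add (integrable_const _))
      measurableSet_Icc h1
  have hcs : ∀ f : ℝ → ℂ, ContinuousOn f (Set.Icc 0 T) →
      ∫ y in Set.Icc 0 T, ‖f y‖ ≤ √(∫ y in Set.Icc 0 T, ‖f y‖ ^ 2) * √T := fun f hf => by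
    have := integral_mul_le_sqrt_mul_sqrt (hf.memLp_Icc.norm) (memLp_const (1 : ℝ))
      (fun x => norm_nonneg (f x)) (fun _ => zero_le_one)
    simpa [hT] using this
  have h3 := hcs u h.continuousOn
  have h4 := hcs v h.continuousOn_deriv
  rcases hT.eq_or_lt with rfl | hT'
  · simp
  have hs : 0 < √T := Real.sqrt_pos.2 hT'
  have hss : √T * √T = T := Real.mul_self_sqrt hT
  refine le_of_mul_le_mul_left ?_ hs
  calc √T * (‖u x‖ * √T) = T * ‖u x‖ := by
        rw [mul_left_comm, hss, mul_comm]
    _ ≤ _ := h2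
    _ ≤ √(∫ y in Set.Icc 0 T, ‖u y‖ ^ 2) * √T
        + T * (√(∫ y in Set.Icc 0 T, ‖v y‖ ^ 2) * √T) := by gcongr
    _ = _ := by ring

/-- The potential energy of `W` is controlled by its mean-square norm and the kinetic energy. -/
theorem abs_integral_mul_sq_le (hT : 0 < T) (h : IsPeriodicH2 T u v w) {W : ℝ → ℝ}
    (hW : MemLp W 2 (volume.restrict (Set.Icc 0 T))) :
    |∫ x in Set.Icc 0 T, W x * ‖u x‖ ^ 2| ≤
      periodNorm T W * (√(∫ y in Set.Icc 0 T, ‖u y‖ ^ 2) *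
        (√(∫ y in Set.Icc 0 T, ‖u y‖ ^ 2) + T * √(∫ y in Set.Icc 0 T, ‖v y‖ ^ 2))) := by
  set N := √(∫ y in Set.Icc 0 T, ‖u y‖ ^ 2)
  set S := N + T * √(∫ y in Set.Icc 0 T, ‖v y‖ ^ 2)
  have hs : 0 < √T := Real.sqrt_pos.2 hT
  have hS : ∀ x ∈ Set.Icc 0 T, ‖u x‖ ≤ S / √T := fun x hx => by
    rw [le_div_iff₀ hs]
    exact h.norm_mul_sqrt_le hx
  have hu2 := h.continuousOn.memLp_Icc.norm
  have hWu : Integrable (fun x => ‖W x‖ * ‖u x‖) (volume.restrict (Set.Icc 0 T)) :=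
    hW.norm.integrable_mul hu2
  have hWN : √(∫ x in Set.Icc 0 T, ‖W x‖ ^ 2) = √T * periodNorm T W := by
    rw [periodNorm, intervalIntegral.integral_of_le hT.le, ← integral_Icc_eq_integral_Ioc,
      ← Real.sqrt_mul hT.le, mul_inv_cancel_left₀ hT.ne']
    simp only [Real.norm_eq_abs]
  have hS0 : 0 ≤ S / √T := (norm_nonneg _).trans (hS 0 ⟨le_rfl, hT.le⟩)
  rw [← Real.norm_eq_abs]
  -- One factor |u| is bounded by its supremum, the other is paired with W by Cauchy–Schwarz. The
  -- factor √T in the L² norm of W cancels the one in the Sobolev bound.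
  calc ‖∫ x in Set.Icc 0 T, W x * ‖u x‖ ^ 2‖
      ≤ ∫ x in Set.Icc 0 T, S / √T * (‖W x‖ * ‖u x‖) := by
        refine norm_integral_le_of_norm_le (hWu.const_mul _)
          ((ae_restrict_iff' measurableSet_Icc).2 (ae_of_all _ fun x hx => ?_))
        rw [norm_mul, norm_pow, norm_norm]
        calc ‖W x‖ * ‖u x‖ ^ 2 = ‖u x‖ * (‖W x‖ * ‖u x‖) := by ring
          _ ≤ _ := mul_le_mul_of_nonneg_right (hS x hx) (by positivity)
    _ = S / √T * ∫ x in Set.Icc 0 T, ‖W x‖ * ‖u x‖ :=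
        integral_const_mul (S / √T) _
    _ ≤ S / √T * (√T * periodNorm T W * N) := by
        rw [← hWN]
        exact mul_le_mul_of_nonneg_left (integral_mul_le_sqrt_mul_sqrt hW.norm hu2
          (fun _ => norm_nonneg _) fun _ => norm_nonneg _) hS0
    _ = periodNorm T W * (N * S) := by field_simp

end IsPeriodicH2

/-! ### The quadratic form of the periodic Schrödinger operator. -/

namespace IsPeriodicH2

variable {T : ℝ} {u v w u' v' w' : ℝ → ℂ} {V : ℝ → ℝ}

/-- u is bounded, so V u is in L². Hence the domain does not depend on V, and test vectors can be
carried from one potential to another. -/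
theorem memLp_neg_add_mul (h : IsPeriodicH2 T u v w)
    (hV : MemLp V 2 (volume.restrict (Set.Icc 0 T))) :
    MemLp (fun x => -w x + (V x : ℂ) * u x) 2 (volume.restrict (Set.Icc 0 T)) := by
  obtain ⟨C, hC⟩ := isCompact_Icc.exists_bound_of_continuousOn h.continuousOn
  refine h.memLp.neg.add (MemLp.of_le_mul (g := V) (c := C) hV ?_ ?_)
  · exact hV.ofReal.1.mul (h.continuousOn.aestronglyMeasurable measurableSet_Icc)
  · refine (ae_restrict_iff' measurableSet_Icc).2 (ae_of_all _ fun x hx => ?_)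
    rw [norm_mul, mul_comm, Complex.norm_real]
    exact mul_le_mul_of_nonneg_right (hC x hx) (norm_nonneg _)

theorem inner_eq (hT : 0 < T) (hV : MemLp V 2 (volume.restrict (Set.Icc 0 T)))
    (h : IsPeriodicH2 T u v w) (h' : IsPeriodicH2 T u' v' w') {x y : L2Period T}
    (hx : x =ᵐ[volume.restrict (Set.Icc (0 : ℝ) T)] u)
    (hy : y =ᵐ[volume.restrict (Set.Icc (0 : ℝ) T)] fun x => -w' x + (V x : ℂ) * u' x) :
    ⟪x, y⟫_ℂ = (∫ t in Set.Icc 0 T, conj (v t) * v' t) +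
      ∫ t in Set.Icc 0 T, (V t : ℂ) * (conj (u t) * u' t) := by
  have hc : ContinuousOn (fun t => conj (u t)) (Set.Icc 0 T) :=
    Complex.continuous_conj.comp_continuousOn h.continuousOn
  have hVi : IntegrableOn (fun t => (V t : ℂ)) (Set.Icc 0 T) := hV.ofReal.integrable (by norm_num)
  have h1 : ⟪x, y⟫_ℂ = ∫ t in Set.Icc 0 T,
      (-(conj (u t) * w' t) + (V t : ℂ) * (conj (u t) * u' t)) := by
    rw [L2.inner_def]
    refine integral_congr_ae ?_
    filter_upwards [hx, hy] with t ht ht'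
    rw [ht, ht', RCLike.inner_apply]
    ring
  rw [h1, integral_add, integral_neg, integral_by_parts hT.le h h', neg_neg]
  · exact (h'.integrableOn.continuousOn_mul hc isCompact_Icc).neg
  · exact hVi.mul_continuousOn (hc.mul h'.continuousOn) isCompact_Icc

theorem norm_sq_eq {x : L2Period T} (hx : x =ᵐ[volume.restrict (Set.Icc (0 : ℝ) T)] u) :
    ‖x‖ ^ 2 = ∫ t in Set.Icc 0 T, ‖u t‖ ^ 2 := by
  have h1 : (⟪x, x⟫_ℂ).re = ‖x‖ ^ 2 := by
    rw [inner_self_eq_norm_sq_to_K]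
    norm_cast
  have h2 : ⟪x, x⟫_ℂ = ((∫ t in Set.Icc 0 T, ‖u t‖ ^ 2 : ℝ) : ℂ) := by
    rw [L2.inner_def, ← integral_complex_ofReal]
    refine integral_congr_ae ?_
    filter_upwards [hx] with t ht
    rw [ht, inner_self_eq_norm_sq_to_K]
    norm_cast
  rw [← h1, h2, Complex.ofReal_re]

theorem re_inner_eq (hT : 0 < T) (hV : MemLp V 2 (volume.restrict (Set.Icc 0 T)))
    (h : IsPeriodicH2 T u v w) {x y : L2Period T}
    (hx : x =ᵐ[volume.restrict (Set.Icc (0 : ℝ) T)] u)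
    (hy : y =ᵐ[volume.restrict (Set.Icc (0 : ℝ) T)] fun x => -w x + (V x : ℂ) * u x) :
    (⟪x, y⟫_ℂ).re = (∫ t in Set.Icc 0 T, ‖v t‖ ^ 2) + ∫ t in Set.Icc 0 T, V t * ‖u t‖ ^ 2 := by
  have h1 : ⟪x, y⟫_ℂ = (((∫ t in Set.Icc 0 T, ‖v t‖ ^ 2) +
      ∫ t in Set.Icc 0 T, V t * ‖u t‖ ^ 2 : ℝ) : ℂ) := by
    rw [inner_eq hT hV h h hx hy, Complex.ofReal_add, ← integral_complex_ofReal,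
      ← integral_complex_ofReal]
    simp only [Complex.conj_mul', Complex.ofReal_mul, Complex.ofReal_pow]
  rw [h1, Complex.ofReal_re]

end IsPeriodicH2

section Form

variable {T : ℝ} {V : ℝ → ℝ}

theorem periodicSchrodinger_symm (hT : 0 < T) (hV : MemLp V 2 (volume.restrict (Set.Icc 0 T))) :
    ∀ p ∈ (periodicSchrodinger T V).graph, ∀ q ∈ (periodicSchrodinger T V).graph,
      ⟪p.1, q.2⟫_ℂ = ⟪p.2, q.1⟫_ℂ := by
  rw [periodicSchrodinger_graph]
  rintro p ⟨u, v, w, h, h1, h2⟩ q ⟨u', v', w', h', h1', h2'⟩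
  rw [← inner_conj_symm p.2 q.1, IsPeriodicH2.inner_eq hT hV h h' h1 h2',
    IsPeriodicH2.inner_eq hT hV h' h h1' h2, map_add, ← integral_conj, ← integral_conj]
  simp only [map_mul, Complex.conj_conj, Complex.conj_ofReal, mul_comm]

/-- The quadratic form of `-d²/dx² + V` is the kinetic energy `K ^ 2` up to a controlled error, and
it changes in a controlled way with `V`. -/
theorem exists_kinetic (hT : 0 < T) (hV : MemLp V 2 (volume.restrict (Set.Icc 0 T)))
    {x y : L2Period T} (hxy : (x, y) ∈ (periodicSchrodinger T V).graph) :
    ∃ K : ℝ, 0 ≤ K ∧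
      K ^ 2 ≤ (⟪x, y⟫_ℂ).re + periodNorm T V * (‖x‖ * (‖x‖ + T * K)) ∧
      ∀ V' : ℝ → ℝ, MemLp V' 2 (volume.restrict (Set.Icc 0 T)) →
        ∃ y', (x, y') ∈ (periodicSchrodinger T V').graph ∧
          (⟪x, y'⟫_ℂ).re ≤ (⟪x, y⟫_ℂ).re +
            periodNorm T (fun t => V' t - V t) * (‖x‖ * (‖x‖ + T * K)) := by
  simp only [periodicSchrodinger_graph] at hxy ⊢
  obtain ⟨u, v, w, h, h1, h2⟩ := hxy
  dsimp only at h1 h2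
  have hN : ‖x‖ = √(∫ t in Set.Icc 0 T, ‖u t‖ ^ 2) := by
    rw [← IsPeriodicH2.norm_sq_eq h1, Real.sqrt_sq (norm_nonneg _)]
  have hK : √(∫ t in Set.Icc 0 T, ‖v t‖ ^ 2) ^ 2 = ∫ t in Set.Icc 0 T, ‖v t‖ ^ 2 :=
    Real.sq_sqrt (integral_nonneg fun t => by positivity)
  refine ⟨√(∫ t in Set.Icc 0 T, ‖v t‖ ^ 2), Real.sqrt_nonneg _, ?_, fun V' hV' => ?_⟩
  · have h3 := h.abs_integral_mul_sq_le hT hV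
    rw [← hN] at h3
    rw [hK, h.re_inner_eq hT hV h1 h2]
    linarith [neg_abs_le (∫ t in Set.Icc 0 T, V t * ‖u t‖ ^ 2)]
  · have hy' := (h.memLp_neg_add_mul hV').coeFn_toLp
    refine ⟨(h.memLp_neg_add_mul hV').toLp _, ⟨u, v, w, h, h1, hy'⟩, ?_⟩
    rw [h.re_inner_eq hT hV h1 h2, h.re_inner_eq hT hV' h1 hy']
    have h3 := h.abs_integral_mul_sq_le hT (hV'.sub hV)
    have hc : ContinuousOn (fun t => ‖u t‖ ^ 2) (Set.Icc 0 T) := h.continuousOn.norm.pow 2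
    have hi : ∀ W : ℝ → ℝ, MemLp W 2 (volume.restrict (Set.Icc 0 T)) →
        IntegrableOn (fun t => W t * ‖u t‖ ^ 2) (Set.Icc 0 T) := fun W hW =>
      IntegrableOn.mul_continuousOn (hW.integrable (by norm_num)) hc isCompact_Icc
    rw [← hN] at h3
    simp only [Pi.sub_apply, sub_mul] at h3
    rw [integral_sub (hi V' hV') (hi V hV)] at h3
    have h4 := (le_abs_self _).trans h3
    have h5 : periodNorm T (V' - V) = periodNorm T fun t => V' t - V t := rfl
    rw [h5] at h4
    linarith

theorem periodNorm_nonneg (T : ℝ) (V : ℝ → ℝ) : 0 ≤ periodNorm T V := Real.sqrt_nonneg _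

theorem le_form (hT : 0 < T) (hV : MemLp V 2 (volume.restrict (Set.Icc 0 T))) {Q : ℝ}
    (hQ : periodNorm T V ≤ Q) :
    ∀ p ∈ (periodicSchrodinger T V).graph, -(Q + T ^ 2 * Q ^ 2) * ‖p.1‖ ^ 2 ≤ (⟪p.1, p.2⟫_ℂ).re := by
  rintro ⟨x, y⟩ hxy
  obtain ⟨K, hK, h1, -⟩ := exists_kinetic hT hV hxy
  have h2 : periodNorm T V * (‖x‖ * (‖x‖ + T * K)) ≤ Q * (‖x‖ * (‖x‖ + T * K)) := by gcongr
  have h3 : 0 ≤ (T * Q * ‖x‖) ^ 2 := sq_nonneg _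
  dsimp only
  -- Completing the square absorbs the term linear in K at a cost of (TQ‖x‖)²/4.
  nlinarith [sq_nonneg (K - T * Q * ‖x‖ / 2)]

/-- Kinetic energy bound for vectors on which the form is at most `E`. -/
theorem kinetic_le {N K E Q P : ℝ} (hT : 0 < T) (hN : 0 ≤ N) (hK : 0 ≤ K) (hP : P ≤ Q)
    (hQ : 0 ≤ Q) (h : K ^ 2 ≤ E * N ^ 2 + P * (N * (N + T * K))) :
    N + T * K ≤ (2 + 2 * (T ^ 2 * Q) + T * √|E|) * N := by
  have h1 : P * (N * (N + T * K)) ≤ Q * (N * (N + T * K)) := by gcongr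
  have h2 : E * N ^ 2 ≤ |E| * N ^ 2 := by gcongr; exact le_abs_self E
  have hs : √|E| ^ 2 = |E| := Real.sq_sqrt (abs_nonneg E)
  set s := √|E|
  have hs0 : 0 ≤ s := Real.sqrt_nonneg _
  rw [← hs] at h2
  -- Multiplying by T² makes the quantities scale-free: Y² ≤ a²N² + qN(N + Y).
  set q := T ^ 2 * Q with hq
  have hq0 : 0 ≤ q := by positivity
  set Y := T * K with hY
  set a := T * s with ha
  have ha0 : 0 ≤ a := by positivity
  have h3 : Y ^ 2 ≤ a ^ 2 * N ^ 2 + q * (N * (N + Y)) := by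
    have := mul_le_mul_of_nonneg_left (h.trans (add_le_add h2 h1)) (sq_nonneg T)
    calc Y ^ 2 = T ^ 2 * K ^ 2 := by rw [hY]; ring
      _ ≤ _ := this
      _ = _ := by rw [ha, hq]; ring
  by_contra hc
  have h4 : (1 + 2 * q + a) * N < Y := by linarith
  have h5 : (1 + q + a) * N < Y - q * N := by linarith
  -- By `h3` the right side is at most (a² + q)N². The left side exceeds that by exactly the
  -- nonnegative quantity in `h7`.
  have h6 : (1 + 2 * q + a) * N * ((1 + q + a) * N) < Y * (Y - q * N) :=
    mul_lt_mul'' h4 h5 (by positivity) (by positivity)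
  have h7 : 0 ≤ N ^ 2 * (1 + 2 * q + 2 * a + 2 * q ^ 2 + 3 * q * a) := by positivity
  nlinarith

end Form

/-! ### Primitives and multipliers between L² and the continuous functions. -/

section Operators

variable {T : ℝ}

/-- Cauchy–Schwarz against 1. This Hölder-1/2 bound supplies both the boundedness and the
equicontinuity needed for Arzelà–Ascoli. -/
theorem norm_integral_le_sqrt_mul_norm (g : L2Period T) {x y : ℝ} (hx : x ∈ Set.Icc 0 T)
    (hy : y ∈ Set.Icc 0 T) : ‖∫ t in x..y, g t‖ ≤ √|y - x| * ‖g‖ := by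
  have hsub : Set.uIoc x y ⊆ Set.Icc 0 T :=
    Set.uIoc_subset_uIcc.trans (Set.uIcc_subset_Icc hx hy)
  have hle : volume.restrict (Set.uIoc x y) ≤ volume.restrict (Set.Icc 0 T) :=
    Measure.restrict_mono hsub le_rfl
  have hg : MemLp (fun t => ‖g t‖) 2 (volume.restrict (Set.Icc 0 T)) := (Lp.memLp g).norm
  have hfin : IsFiniteMeasure (volume.restrict (Set.uIoc x y)) :=
    ⟨by rw [Measure.restrict_apply_univ, Set.uIoc, Real.volume_Ioc]; exact ENNReal.ofReal_lt_top⟩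
  have h1 := integral_mul_le_sqrt_mul_sqrt (memLp_const (1 : ℝ)) (hg.mono_measure hle)
    (fun _ => zero_le_one) (fun t => norm_nonneg (g t))
  have h2 : ∫ t in Set.uIoc x y, ‖g t‖ ^ 2 ≤ ∫ t in Set.Icc 0 T, ‖g t‖ ^ 2 :=
    setIntegral_mono_set hg.integrable_sq (ae_of_all _ fun t => by positivity) hsub.eventuallyLE
  have h3 : ‖g‖ = √(∫ t in Set.Icc 0 T, ‖g t‖ ^ 2) := by
    rw [← IsPeriodicH2.norm_sq_eq (ae_eq_refl g), Real.sqrt_sq (norm_nonneg _)]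
  have h4 : ∫ _ in Set.uIoc x y, (1 : ℝ) ^ 2 = |y - x| := by
    simp [Set.uIoc, measureReal_def, max_sub_min_eq_abs]
  rw [h4] at h1
  simp only [one_mul] at h1
  rw [h3]
  exact intervalIntegral.norm_integral_le_integral_norm_uIoc.trans (h1.trans (by gcongr))

theorem intervalIntegrable_coeFn (g : L2Period T) {x y : ℝ} (hx : x ∈ Set.Icc 0 T)
    (hy : y ∈ Set.Icc 0 T) : IntervalIntegrable g volume x y := by
  rw [intervalIntegrable_iff]
  exact IntegrableOn.mono_set (Lp.memLp g |>.integrable (by norm_num))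
    (Set.uIoc_subset_uIcc.trans (Set.uIcc_subset_Icc hx hy))

theorem integral_congr_ae_Icc {E : Type*} [NormedAddCommGroup E] [NormedSpace ℝ E] {f g : ℝ → E}
    (h : f =ᵐ[volume.restrict (Set.Icc 0 T)] g) {x : ℝ} (hx : x ∈ Set.Icc 0 T) :
    ∫ t in (0 : ℝ)..x, f t = ∫ t in (0 : ℝ)..x, g t := by
  refine intervalIntegral.integral_congr_ae_restrict (ae_mono (Measure.restrict_mono ?_ le_rfl) h)
  exact Set.uIoc_subset_uIcc.trans (Set.uIcc_subset_Icc ⟨le_rfl, hx.1.trans hx.2⟩ hx)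

/-- The primitive vanishing at `0`, as a compact operator to the continuous functions. -/
theorem exists_primitive (hT : 0 < T) :
    ∃ S : L2Period T →L[ℂ] (Set.Icc 0 T →ᵇ ℂ), IsCompactOperator S ∧
      ∀ g x, S g x = ∫ t in (0 : ℝ)..x, g t := by
  have h0 : (0 : ℝ) ∈ Set.Icc 0 T := ⟨le_rfl, hT.le⟩
  have hdist : ∀ (g : L2Period T) (x y : Set.Icc 0 T),
      dist (∫ t in (0 : ℝ)..x, g t) (∫ t in (0 : ℝ)..y, g t) ≤ √(dist x y) * ‖g‖ := fun g x y => by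
    rw [dist_eq_norm, intervalIntegral.integral_interval_sub_left
      (intervalIntegrable_coeFn g h0 x.2) (intervalIntegrable_coeFn g h0 y.2), Subtype.dist_eq,
      Real.dist_eq]
    exact norm_integral_le_sqrt_mul_norm g y.2 x.2
  have hcont : ∀ g : L2Period T, Continuous fun x : Set.Icc 0 T => ∫ t in (0 : ℝ)..x, g t :=
    fun g => continuous_iff_continuousAt.2 fun y => by
      refine tendsto_iff_dist_tendsto_zero.2 (squeeze_zero (fun _ => dist_nonneg)
        (fun x => hdist g x y) ?_)
      have : Continuous fun x : Set.Icc 0 T => √(dist x y) * ‖g‖ := by fun_prop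
      simpa using this.tendsto y
  have hbound : ∀ (g : L2Period T) (x : Set.Icc 0 T), ‖∫ t in (0 : ℝ)..x, g t‖ ≤ √T * ‖g‖ :=
    fun g x => by
      refine (norm_integral_le_sqrt_mul_norm g h0 x.2).trans ?_
      gcongr
      rw [sub_zero, abs_of_nonneg x.2.1]
      exact x.2.2
  let S₀ : L2Period T →ₗ[ℂ] (Set.Icc 0 T →ᵇ ℂ) :=
    { toFun := fun g => .mkOfCompact ⟨fun x => ∫ t in (0 : ℝ)..x, g t, hcont g⟩
      map_add' := fun f g => by
        ext x
        change ∫ t in (0 : ℝ)..x, (f + g : L2Period T) t =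
          (∫ t in (0 : ℝ)..x, f t) + ∫ t in (0 : ℝ)..x, g t
        rw [integral_congr_ae_Icc (Lp.coeFn_add f g) x.2]
        exact intervalIntegral.integral_add (intervalIntegrable_coeFn f h0 x.2)
          (intervalIntegrable_coeFn g h0 x.2)
      map_smul' := fun c g => by
        ext x
        change ∫ t in (0 : ℝ)..x, (c • g : L2Period T) t = c • ∫ t in (0 : ℝ)..x, g t
        rw [integral_congr_ae_Icc (Lp.coeFn_smul c g) x.2]
        exact intervalIntegral.integral_smul c g }
  let S := S₀.mkContinuous (√T) fun g =>
    (BoundedContinuousFunction.norm_le (by positivity)).2 (hbound g)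
  refine ⟨S, ?_, fun g x => rfl⟩
  refine (isCompactOperator_iff_isCompact_closure_image_closedBall
    S.toLinearMap one_pos).2 ?_
  refine BoundedContinuousFunction.arzela_ascoli (Metric.closedBall 0 (√T))
    (isCompact_closedBall _ _) _ ?_ ?_
  · rintro _ x ⟨g, hg, rfl⟩
    rw [mem_closedBall_zero_iff] at hg ⊢
    exact (hbound g x).trans (mul_le_of_le_one_right (Real.sqrt_nonneg _) hg)
  · refine Metric.equicontinuous_of_continuity_modulus (fun r => √r) ?_ _ ?_
    · simpa using Real.continuous_sqrt.tendsto 0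
    · rintro x y ⟨_, g, hg, rfl⟩
      rw [mem_closedBall_zero_iff] at hg
      exact (hdist g x y).trans (mul_le_of_le_one_right (Real.sqrt_nonneg _) hg)

/-- Multiplication by a square-integrable function, as an operator on the continuous functions. -/
theorem exists_multiplication (hT : 0 < T) {F : ℝ → ℂ}
    (hF : MemLp F 2 (volume.restrict (Set.Icc 0 T))) :
    ∃ M : (Set.Icc 0 T →ᵇ ℂ) →L[ℂ] L2Period T, ∀ f : Set.Icc 0 T →ᵇ ℂ,
      M f =ᵐ[volume.restrict (Set.Icc 0 T)] fun t => F t * Set.IccExtend hT.le f t := by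
  have hb : ∀ (f : Set.Icc 0 T →ᵇ ℂ) (t : ℝ),
      ‖F t * Set.IccExtend hT.le f t‖ ≤ ‖f‖ * ‖F t‖ := fun f t => by
    rw [norm_mul, mul_comm]
    exact mul_le_mul_of_nonneg_right (f.norm_coe_le_norm _) (norm_nonneg _)
  have hmem : ∀ f : Set.Icc 0 T →ᵇ ℂ, MemLp (fun t => F t * Set.IccExtend hT.le f t) 2
      (volume.restrict (Set.Icc 0 T)) := fun f =>
    hF.of_le_mul (hF.1.mul (f.continuous.Icc_extend' (h := hT.le)).aestronglyMeasurable)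
      (ae_of_all _ (hb f))
  let M₀ : (Set.Icc 0 T →ᵇ ℂ) →ₗ[ℂ] L2Period T :=
    { toFun := fun f => (hmem f).toLp _
      map_add' := fun f g => by
        rw [← MemLp.toLp_add]
        congr 1
        ext t
        simp [Set.IccExtend, mul_add]
      map_smul' := fun c f => by
        rw [RingHom.id_apply, ← MemLp.toLp_const_smul]
        congr 1
        ext t
        simp [Set.IccExtend, mul_left_comm] }
  refine ⟨M₀.mkContinuous ‖hF.toLp F‖ fun f => ?_, fun f => (hmem f).coeFn_toLp⟩
  rw [mul_comm]
  refine Lp.norm_le_mul_norm_of_ae_le_mul ?_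
  filter_upwards [(hmem f).coeFn_toLp, hF.coeFn_toLp] with t h1 h2
  change ‖(hmem f).toLp _ t‖ ≤ _
  rw [h1, h2]
  exact hb f t

end Operators

/-! ### The free solution operator, the parametrix and the compact resolvent. -/

section Resolvent

variable {T : ℝ}

/-- The solution operator of `-u'' + u(0) = g` with periodic boundary conditions. -/
theorem exists_free_solution (hT : 0 < T) :
    ∃ G : L2Period T →L[ℂ] (Set.Icc 0 T →ᵇ ℂ), IsCompactOperator G ∧
      ∀ g : L2Period T, ∃ v : ℝ → ℂ, IsPeriodicH2 T (Set.IccExtend hT.le (G g)) v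
        (fun t => G g ⟨0, le_rfl, hT.le⟩ - g t) := by
  obtain ⟨S, hS, hSg⟩ := exists_primitive hT
  obtain ⟨J, hJ⟩ := exists_multiplication hT (memLp_const (1 : ℂ))
  simp only [one_mul] at hJ
  have h0m : (0 : ℝ) ∈ Set.Icc 0 T := ⟨le_rfl, hT.le⟩
  have hTm : T ∈ Set.Icc 0 T := ⟨hT.le, le_rfl⟩
  have hSJ : ∀ (f : Set.Icc 0 T →ᵇ ℂ) (x : Set.Icc 0 T),
      S (J f) x = ∫ t in (0 : ℝ)..x, Set.IccExtend hT.le f t := fun f x => by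
    rw [hSg, integral_congr_ae_Icc (hJ f) x.2]
  let evT := BoundedContinuousFunction.evalCLM ℂ (⟨T, hTm⟩ : Set.Icc 0 T) (β := ℂ)
  let one : Set.Icc 0 T →ᵇ ℂ := BoundedContinuousFunction.const _ 1
  let idf : Set.Icc 0 T →ᵇ ℂ :=
    .mkOfCompact ⟨fun x => ((x : ℝ) : ℂ), Complex.continuous_ofReal.comp continuous_subtype_val⟩
  -- Integrating u'' = u(0) - g over the period forces u(0) to be the mean of g. Then `V₀` is u' -
  -- u'(0), and subtracting its mean `shift` gives u' integral zero, so that u(T) = u(0).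
  let mean : L2Period T →L[ℂ] ℂ := (T : ℂ)⁻¹ • (evT ∘L S)
  let V₀ : L2Period T →L[ℂ] (Set.Icc 0 T →ᵇ ℂ) := mean.smulRight idf - S
  let shift : L2Period T →L[ℂ] ℂ := (T : ℂ)⁻¹ • (evT ∘L S ∘L J ∘L V₀)
  let V : L2Period T →L[ℂ] (Set.Icc 0 T →ᵇ ℂ) := V₀ - shift.smulRight one
  let G : L2Period T →L[ℂ] (Set.Icc 0 T →ᵇ ℂ) := mean.smulRight one + S ∘L (J ∘L V)
  have hTne : (T : ℂ) ≠ 0 := by exact_mod_cast hT.ne'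
  have hGx : ∀ g x, G g x = mean g + ∫ t in (0 : ℝ)..x, Set.IccExtend hT.le (V g) t := fun g x => by
    rw [← hSJ]
    simp [G, one]
  have hVx : ∀ (g : L2Period T) (x : Set.Icc 0 T),
      V g x = (∫ t in (0 : ℝ)..x, (mean g - g t)) - shift g := fun g x => by
    rw [intervalIntegral.integral_sub (intervalIntegrable_const)
      (intervalIntegrable_coeFn g h0m x.2), ← hSg, intervalIntegral.integral_const]
    simp [V, V₀, one, idf, mul_comm]
  have hG0 : ∀ g, G g ⟨0, h0m⟩ = mean g := fun g => by simp [hGx]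
  refine ⟨G, ?_, fun g => ⟨Set.IccExtend hT.le (V g), ?_⟩⟩
  · have h1 : IsCompactOperator mean := (hS.clm_comp evT).smul (T : ℂ)⁻¹
    have h2 : IsCompactOperator (mean.smulRight one) :=
      h1.clm_comp (ContinuousLinearMap.toSpanSingleton ℂ one)
    exact h2.add (hS.comp_clm (J ∘L V))
  · have hu0 : Set.IccExtend hT.le (G g) 0 = mean g := by
      rw [Set.IccExtend_of_mem _ _ h0m, hG0]
    have hv0 : Set.IccExtend hT.le (V g) 0 = -shift g := by
      rw [Set.IccExtend_of_mem _ _ h0m, hVx]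
      simp
    refine ⟨?_, fun x hx => ?_, fun x hx => ?_, ?_, ?_⟩
    · exact (memLp_const _).sub (Lp.memLp g)
    · rw [Set.IccExtend_of_mem _ _ hx, hGx, hu0]
    · rw [Set.IccExtend_of_mem _ _ hx, hVx, hv0, hG0]
      ring
    · rw [hu0, Set.IccExtend_of_mem _ _ hTm, hGx, ← hSJ]
      have h1 : S (J one) ⟨T, hTm⟩ = T := by
        rw [hSJ]
        simp [one, Set.IccExtend]
      have h2 : S (J (V g)) ⟨T, hTm⟩ =
          S (J (V₀ g)) ⟨T, hTm⟩ - shift g * S (J one) ⟨T, hTm⟩ := by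
        simp [V]
      have h3 : shift g = (T : ℂ)⁻¹ * S (J (V₀ g)) ⟨T, hTm⟩ := by simp [shift, evT]
      rw [h2, h1, h3]
      field_simp
      ring
    · rw [hv0, Set.IccExtend_of_mem _ _ hTm, hVx, intervalIntegral.integral_sub
        (intervalIntegrable_const) (intervalIntegrable_coeFn g h0m hTm),
        intervalIntegral.integral_const]
      have h3 : mean g = (T : ℂ)⁻¹ * ∫ t in (0 : ℝ)..T, g t := by
        rw [← hSg g ⟨T, hTm⟩]
        simp [mean, evT]
      rw [h3, sub_zero, Complex.real_smul, mul_inv_cancel_left₀ hTne]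
      ring

end Resolvent

/-- The Fredholm alternative for `1 + K`. -/
theorem IsCompactOperator.exists_right_inverse_one_add {X : Type*} [NormedAddCommGroup X]
    [NormedSpace ℂ X] [CompleteSpace X] {K : X →L[ℂ] X} (hK : IsCompactOperator K)
    (hinj : ∀ x, x + K x = 0 → x = 0) : ∃ B : X →L[ℂ] X, ∀ x, B x + K (B x) = x := by
  have hunit : IsUnit (1 + K) := by
    have h1 := hK.hasEigenvalue_or_mem_resolventSet (μ := (-1 : ℂ)) (by norm_num)
    have h2 : ¬ Module.End.HasEigenvalue (K : Module.End ℂ X) (-1 : ℂ) := fun h => by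
      obtain ⟨g, hg, hg0⟩ := h.exists_hasEigenvector
      refine hg0 (hinj g ?_)
      have : K g = (-1 : ℂ) • g := Module.End.mem_eigenspace_iff.1 hg
      rw [this, neg_one_smul, add_neg_cancel]
    have h3 := h1.resolve_left h2
    rw [spectrum.mem_resolventSet_iff, ← IsUnit.neg_iff] at h3
    convert h3 using 1
    rw [map_neg, map_one, neg_sub, sub_neg_eq_add, add_comm]
  obtain ⟨B, hB⟩ := hunit.exists_right_inv
  exact ⟨B, fun f => by simpa using DFunLike.congr_fun hB f⟩

section Resolvent

variable {T : ℝ}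

/-- The resolvent equation `(-d²/dx² + V + c) N g = g + K g` for the free solution operator `N`. -/
theorem exists_parametrix (hT : 0 < T) {V : ℝ → ℝ}
    (hV : MemLp V 2 (volume.restrict (Set.Icc 0 T))) (c : ℝ) :
    ∃ N K : L2Period T →L[ℂ] L2Period T, IsCompactOperator N ∧ IsCompactOperator K ∧
      (∀ g, (N g, g + K g - (c : ℂ) • N g) ∈ (periodicSchrodinger T V).graph) ∧
      ∀ g, N g = 0 → g = 0 := by
  obtain ⟨G, hG, hGg⟩ := exists_free_solution hT
  obtain ⟨J, hJ⟩ := exists_multiplication hT (memLp_const (1 : ℂ))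
  have hVc : MemLp (fun t => (V t : ℂ)) 2 (volume.restrict (Set.Icc 0 T)) := hV.ofReal
  have hF : MemLp (fun t => (V t : ℂ) + (c : ℂ)) 2 (volume.restrict (Set.Icc 0 T)) :=
    hVc.add (memLp_const (c : ℂ))
  obtain ⟨M, hM⟩ := exists_multiplication hT hF
  simp only [one_mul] at hJ
  have h0m : (0 : ℝ) ∈ Set.Icc 0 T := ⟨le_rfl, hT.le⟩
  -- With u = G g, K g = (V + c)u - u(0) is the error made by solving -u'' + u(0) = g instead of the
  -- full equation. It is a bounded image of `G g`, hence compact in g.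
  obtain ⟨K, hKc, hK⟩ : ∃ K : L2Period T →L[ℂ] L2Period T, IsCompactOperator K ∧ ∀ g,
      K g =ᵐ[volume.restrict (Set.Icc 0 T)] fun t =>
        ((V t : ℂ) + c) * Set.IccExtend hT.le (G g) t - G g ⟨0, h0m⟩ := by
    let ev0 := BoundedContinuousFunction.evalCLM ℂ (⟨0, h0m⟩ : Set.Icc 0 T) (β := ℂ)
    let one : Set.Icc 0 T →ᵇ ℂ := BoundedContinuousFunction.const _ 1
    refine ⟨(M - ev0.smulRight (J one)) ∘L G, hG.clm_comp (M - ev0.smulRight (J one)), fun g => ?_⟩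
    have h1 : ((M - ev0.smulRight (J one)) ∘L G) g = M (G g) - G g ⟨0, h0m⟩ • J one := rfl
    rw [h1]
    filter_upwards [hM (G g), hJ one, Lp.coeFn_sub (M (G g)) (G g ⟨0, h0m⟩ • J one),
      Lp.coeFn_smul (G g ⟨0, h0m⟩) (J one)] with t h2 h3 h4 h5
    rw [h4, Pi.sub_apply, h5, Pi.smul_apply, h2, h3]
    simp [one, Set.IccExtend]
  refine ⟨J ∘L G, K, hG.clm_comp J, hKc, fun g => ?_, fun g hg => ?_⟩
  · obtain ⟨v, hv⟩ := hGg g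
    rw [periodicSchrodinger_graph]
    refine ⟨_, v, _, hv, hJ _, ?_⟩
    filter_upwards [hK g, hJ (G g), Lp.coeFn_sub (g + K g) ((c : ℂ) • J (G g)),
      Lp.coeFn_add g (K g), Lp.coeFn_smul (c : ℂ) (J (G g))] with t h1 h2 h3 h4 h5
    rw [ContinuousLinearMap.comp_apply, h3, Pi.sub_apply, h4, h5, Pi.add_apply, Pi.smul_apply, h1,
      h2, smul_eq_mul]
    ring
  · have h4 : Set.IccExtend hT.le (G g) =ᵐ[volume.restrict (Set.Icc 0 T)] 0 := by
      have h6 := hJ (G g)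
      rw [show J (G g) = 0 from hg] at h6
      exact h6.symm.trans (Lp.coeFn_zero _ _ _)
    obtain ⟨v, hv⟩ := hGg g
    have h5 := Measure.eqOn_Icc_of_ae_eq volume hT.ne h4 hv.continuousOn continuousOn_const h0m
    rw [Set.IccExtend_of_mem _ _ h0m] at h5
    refine Lp.ext ?_
    filter_upwards [hv.ae_eq_zero h4, Lp.coeFn_zero ℂ 2 (volume.restrict (Set.Icc (0 : ℝ) T))]
      with t h6 h7
    rw [h5] at h6
    have h8 : g t = 0 := by simpa using h6
    exact h8.trans h7.symm

/-- The operator `-d²/dx² + V + c` has a compact inverse when `c` exceeds the lower bound `m` of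
its form. -/
theorem exists_compact_resolvent (hT : 0 < T) {V : ℝ → ℝ}
    (hV : MemLp V 2 (volume.restrict (Set.Icc 0 T))) {m c : ℝ} (hmc : m < c)
    (hm : ∀ p ∈ (periodicSchrodinger T V).graph,
      -m * ‖p.1‖ ^ 2 ≤ (inner ℂ p.1 p.2).re) :
    ∃ R : L2Period T →L[ℂ] L2Period T, IsCompactOperator R ∧
      ∀ f, (R f, f - (c : ℂ) • R f) ∈ (periodicSchrodinger T V).graph := by
  obtain ⟨N, K, hN, hK, hgraph, hN0⟩ := exists_parametrix hT hV c
  -- If g + K g = 0, then N g is in the domain and is sent to -c N g. The form is then -c‖N g‖²,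
  -- which the lower bound with m < c allows only for N g = 0.
  obtain ⟨B, hB⟩ := hK.exists_right_inverse_one_add fun g hg => by
    refine hN0 g ?_
    have h1 := hgraph g
    rw [hg, zero_sub] at h1
    have h2 := hm _ h1
    have h3 : (inner ℂ (N g) (-((c : ℂ) • N g))).re = -c * ‖N g‖ ^ 2 := by
      rw [inner_neg_right, inner_smul_right, inner_self_eq_norm_sq_to_K, neg_mul, Complex.neg_re,
        Complex.re_ofReal_mul]
      norm_cast
    have h5 : -m * ‖N g‖ ^ 2 ≤ -c * ‖N g‖ ^ 2 := h2.trans h3.le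
    have h6 : ‖N g‖ ^ 2 = 0 := le_antisymm (by nlinarith) (sq_nonneg _)
    exact norm_eq_zero.1 (pow_eq_zero_iff two_ne_zero |>.1 h6)
  refine ⟨N ∘L B, hN.comp_clm B, fun f => ?_⟩
  have := hgraph (B f)
  rwa [hB] at this

end Resolvent

/-! ### Eigenvalue bounds and comparison. -/

section Comparison

variable {T : ℝ}

/-- Polynomials embed in L², since one vanishing almost everywhere on the interval has infinitely
many roots. This makes the eigenbasis infinite, so an n-th eigenvalue exists for every n. -/
theorem infinite_dimensional_L2Period (hT : 0 < T) : ¬ FiniteDimensional ℂ (L2Period T) := by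
  intro hfd
  have hmem : ∀ p : Polynomial ℂ, MemLp (fun t : ℝ => p.eval (t : ℂ)) 2
      (volume.restrict (Set.Icc 0 T)) := fun p =>
    ContinuousOn.memLp_Icc (p.continuous.comp Complex.continuous_ofReal).continuousOn
  let f : Polynomial ℂ →ₗ[ℂ] L2Period T :=
    { toFun := fun p => (hmem p).toLp _
      map_add' := fun p q => by
        rw [← MemLp.toLp_add]
        congr 1
        ext t
        simp
      map_smul' := fun c p => by
        rw [RingHom.id_apply, ← MemLp.toLp_const_smul]
        congr 1
        ext t
        simp }
  have hf : Function.Injective f := by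
    refine (injective_iff_map_eq_zero f).2 fun p hp => ?_
    have h1 : (fun t : ℝ => p.eval (t : ℂ)) =ᵐ[volume.restrict (Set.Icc 0 T)] fun _ => 0 := by
      refine (hmem p).coeFn_toLp.symm.trans ?_
      rw [show (hmem p).toLp _ = 0 from hp]
      exact Lp.coeFn_zero _ _ _
    have h2 := Measure.eqOn_Icc_of_ae_eq volume hT.ne h1
      (p.continuous.comp Complex.continuous_ofReal).continuousOn continuousOn_const
    refine Polynomial.eq_zero_of_infinite_isRoot p
      (Set.Infinite.mono ?_ ((Set.Icc_infinite hT).image Complex.ofReal_injective.injOn))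
    rintro _ ⟨t, ht, rfl⟩
    exact h2 ht
  exact Polynomial.not_finite (Module.Finite.of_injective f hf)

/-- `-d²/dx² + V` with periodic boundary conditions has an orthonormal basis of eigenvectors. -/
theorem exists_periodicSchrodinger_isDiagonalizedBy (hT : 0 < T) {V : ℝ → ℝ}
    (hV : MemLp V 2 (volume.restrict (Set.Icc 0 T))) :
    ∃ (ι : Type) (b : HilbertBasis ι ℂ (L2Period T)) (l : ι → ℝ), Infinite ι ∧
      (periodicSchrodinger T V).IsDiagonalizedBy b l := by
  have hlow := le_form hT hV le_rfl
  obtain ⟨R, hR, hRA⟩ := exists_compact_resolvent hT hV (lt_add_one _) hlow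
  obtain ⟨ι, b, l, h⟩ := LinearPMap.exists_isDiagonalizedBy (periodicSchrodinger_symm hT hV)
    (lt_add_one _) hlow hR hRA
  refine ⟨ι, b, l, ?_, h⟩
  by_contra hι
  have := fintypeOfNotInfinite hι
  exact infinite_dimensional_L2Period hT b.toOrthonormalBasis.toBasis.finiteDimensional_of_finite

/-- Any nonzero vector of the n-th test space has its Rayleigh quotient between the lower bound of
the form and the n-th eigenvalue. -/
theorem le_periodicEigenvalue (hT : 0 < T) {V : ℝ → ℝ} {Q : ℝ}
    (hV : MemLp V 2 (volume.restrict (Set.Icc 0 T))) (hQ : periodNorm T V ≤ Q) {n : ℕ}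
    (hn : 1 ≤ n) : -(Q + T ^ 2 * Q ^ 2) ≤ periodicEigenvalue T V n := by
  obtain ⟨ι, b, l, hι, h⟩ := exists_periodicSchrodinger_isDiagonalizedBy hT hV
  obtain ⟨W, hW, hWn, hform⟩ := h.exists_finrank_ge hn
  obtain ⟨⟨x, hxW⟩, hx⟩ : ∃ x : W, x ≠ 0 := by
    have := Module.nontrivial_of_finrank_pos (R := ℂ) (M := W) (by omega)
    exact exists_ne 0
  obtain ⟨y, hxy, hle⟩ := hform x hxW
  have h1 := (le_form hT hV hQ _ hxy).trans hle
  have hx' : 0 < ‖x‖ ^ 2 := by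
    have : x ≠ 0 := fun h => hx (Subtype.ext h)
    positivity
  exact le_of_mul_le_mul_right h1 hx'

/-- One-sided eigenvalue comparison. -/
theorem periodicEigenvalue_le_add (hT : 0 < T) {V V' : ℝ → ℝ} {Q : ℝ}
    (hV : MemLp V 2 (volume.restrict (Set.Icc 0 T)))
    (hV' : MemLp V' 2 (volume.restrict (Set.Icc 0 T))) (hQ : periodNorm T V ≤ Q) {n : ℕ}
    (hn : 1 ≤ n) :
    periodicEigenvalue T V' n ≤ periodicEigenvalue T V n +
      periodNorm T (fun t => V' t - V t) *
        (2 + 2 * (T ^ 2 * Q) + T * √|periodicEigenvalue T V n|) := by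
  obtain ⟨ι, b, l, hι, h⟩ := exists_periodicSchrodinger_isDiagonalizedBy hT hV
  obtain ⟨ι', b', l', hι', h'⟩ := exists_periodicSchrodinger_isDiagonalizedBy hT hV'
  obtain ⟨W, hW, hWn, hform⟩ := h.exists_finrank_ge hn
  -- `W` comes from the eigenvectors for V and serves as test space for V'.
  refine h'.nthEigenvalue_le_of_form_le hn W hWn fun x hx => ?_
  obtain ⟨y, hxy, hle⟩ := hform x hx
  obtain ⟨K, hK, hK2, hV2⟩ := exists_kinetic hT hV hxy
  obtain ⟨y', hxy', hle'⟩ := hV2 V' hV'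
  refine ⟨y', hxy', hle'.trans ?_⟩
  have hN := norm_nonneg x
  have hkin := kinetic_le hT hN hK hQ ((periodNorm_nonneg T V).trans hQ)
    (hK2.trans (add_le_add_left hle _))
  have hd := periodNorm_nonneg T fun t => V' t - V t
  change _ ≤ (periodicEigenvalue T V n + _) * ‖x‖ ^ 2
  change _ ≤ periodicEigenvalue T V n * ‖x‖ ^ 2 at hle
  calc _ ≤ periodicEigenvalue T V n * ‖x‖ ^ 2 + periodNorm T (fun t => V' t - V t) *
        (‖x‖ * ((2 + 2 * (T ^ 2 * Q) + T * √|periodicEigenvalue T V n|) * ‖x‖)) := by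
        refine add_le_add hle ?_
        gcongr
        exact hkin
    _ = _ := by ring

theorem periodNorm_sub_comm (T : ℝ) (V V' : ℝ → ℝ) :
    periodNorm T (fun t => V t - V' t) = periodNorm T (fun t => V' t - V t) := by
  simp only [periodNorm, abs_sub_comm]

end Comparison

theorem theorem3p1 :
    ∃ C₁ : ℝ, 0 < C₁ ∧ ∀ (T Q : ℝ) (V₁ V₂ : ℝ → ℝ), 0 < T → 0 < Q →
      MemLp V₁ 2 (volume.restrict (Set.Icc (0 : ℝ) T)) →
      MemLp V₂ 2 (volume.restrict (Set.Icc (0 : ℝ) T)) →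
      periodNorm T V₁ ≤ Q → periodNorm T V₂ ≤ Q →
      (periodicSchrodinger T V₁).IsEigenvalueEnumeration (periodicEigenvalue T V₁) ∧
      (periodicSchrodinger T V₂).IsEigenvalueEnumeration (periodicEigenvalue T V₂) ∧
      -C₁ * (Q + T ^ 2 * Q ^ 2) ≤ periodicEigenvalue T V₁ 1 ∧
      -C₁ * (Q + T ^ 2 * Q ^ 2) ≤ periodicEigenvalue T V₂ 1 ∧
      ∀ n : ℕ, 1 ≤ n →
        |periodicEigenvalue T V₁ n - periodicEigenvalue T V₂ n| ≤
          C₁ * (1 + T ^ 2 * Q) * (1 + T * Real.sqrt |periodicEigenvalue T V₂ n|) *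
            periodNorm T (fun x => V₁ x - V₂ x) := by
  have henum : ∀ (T : ℝ) (V : ℝ → ℝ), 0 < T → MemLp V 2 (volume.restrict (Set.Icc (0 : ℝ) T)) →
      (periodicSchrodinger T V).IsEigenvalueEnumeration (periodicEigenvalue T V) := by
    intro T V hT hV
    obtain ⟨ι, b, l, hι, h⟩ := exists_periodicSchrodinger_isDiagonalizedBy hT hV
    exact h.isEigenvalueEnumeration
  have hlow : ∀ (T Q : ℝ) (V : ℝ → ℝ), 0 < T → 0 < Q →
      MemLp V 2 (volume.restrict (Set.Icc (0 : ℝ) T)) → periodNorm T V ≤ Q →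
      -3 * (Q + T ^ 2 * Q ^ 2) ≤ periodicEigenvalue T V 1 := by
    intro T Q V hT hQ hV hVQ
    have h1 := le_periodicEigenvalue hT hV hVQ le_rfl
    have h2 : 0 ≤ Q + T ^ 2 * Q ^ 2 := by positivity
    linarith
  -- The 3 is the 2 of the one-sided comparison plus the 1 lost in replacing √|E₁| by √|E₂|.
  refine ⟨3, by norm_num, fun T Q V₁ V₂ hT hQ hV₁ hV₂ hQ₁ hQ₂ => ⟨henum T V₁ hT hV₁,
    henum T V₂ hT hV₂, hlow T Q V₁ hT hQ hV₁ hQ₁, hlow T Q V₂ hT hQ hV₂ hQ₂, fun n hn => ?_⟩⟩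
  have h12 := periodicEigenvalue_le_add hT hV₂ hV₁ hQ₂ hn
  have h21 := periodicEigenvalue_le_add hT hV₁ hV₂ hQ₁ hn
  have hl1 := le_periodicEigenvalue hT hV₁ hQ₁ hn
  rw [periodNorm_sub_comm T V₂ V₁] at h21
  have hd := periodNorm_nonneg T fun x => V₁ x - V₂ x
  set d := periodNorm T fun x => V₁ x - V₂ x
  set E₁ := periodicEigenvalue T V₁ n
  set E₂ := periodicEigenvalue T V₂ n
  have hq : 0 ≤ T ^ 2 * Q := by positivity
  have hs : 0 ≤ T * √|E₂| := by positivity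
  have hfac : 3 + 3 * (T ^ 2 * Q) + T * √|E₂| ≤
      3 * (1 + T ^ 2 * Q) * (1 + T * √|E₂|) := by nlinarith [mul_nonneg hq hs]
  have hfac' : d * (3 + 3 * (T ^ 2 * Q) + T * √|E₂|) ≤
      3 * (1 + T ^ 2 * Q) * (1 + T * √|E₂|) * d := by
    rw [mul_comm d]
    gcongr
  rcases le_total E₂ E₁ with h | h
  · rw [abs_of_nonneg (sub_nonneg.2 h)]
    have : d * (2 + 2 * (T ^ 2 * Q) + T * √|E₂|) ≤ d * (3 + 3 * (T ^ 2 * Q) + T * √|E₂|) := by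
      exact mul_le_mul_of_nonneg_left (by linarith) hd
    linarith
  · rw [abs_sub_comm, abs_of_nonneg (sub_nonneg.2 h)]
    -- Here the comparison involves √|E₁|. Since E₁ ≤ E₂, |E₁| can exceed |E₂| only when E₁ is
    -- negative, where the lower bound applies.
    have hE : |E₁| ≤ |E₂| + (Q + T ^ 2 * Q ^ 2) := by
      have : 0 ≤ Q + T ^ 2 * Q ^ 2 := by positivity
      exact abs_le.2 ⟨by linarith [abs_nonneg E₂], by linarith [le_abs_self E₂]⟩
    -- With q = T²Q, the extra term after scaling by T² is q + q² ≤ (1 + q)².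
    have hsq : T * √|E₁| ≤ T * √|E₂| + (1 + T ^ 2 * Q) := by
      refine abs_le_of_sq_le_sq' ?_ (by positivity) |>.2
      rw [mul_pow, Real.sq_sqrt (abs_nonneg _)]
      have h2 : (T * √|E₂|) ^ 2 = T ^ 2 * |E₂| := by
        rw [mul_pow, Real.sq_sqrt (abs_nonneg _)]
      have h3 : T ^ 2 * |E₁| ≤ T ^ 2 * (|E₂| + (Q + T ^ 2 * Q ^ 2)) := by gcongr
      nlinarith [mul_nonneg hs hq]
    have : d * (2 + 2 * (T ^ 2 * Q) + T * √|E₁|) ≤ d * (3 + 3 * (T ^ 2 * Q) + T * √|E₂|) := by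
      exact mul_le_mul_of_nonneg_left (by linarith) hd
    linarith
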